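/- Let $S$ be a finite set of primes (so $\infty\notin S$), let $d\ge 1$, $m\ge 0$ and $n=d+m$. For $k\ge1$ put $\mathbb{Z}_S^k=\prod_{\nu\in S}\mathbb{Z}_\nu^k$, and let $\mu_{S,d}$ be the Haar probability measure on $\mathbb{Z}_S^d$, i.e. the product of the Haar probability measures on the factors $\mathbb{Z}_\nu$. For every $\nu\in S$ let $\mathcal{U}_\nu\subseteq\mathbb{Z}_\nu^d$ be open and let $\mathbf{f}_\nu:\mathcal{U}_\nu\to\mathbb{Z}_\nu^m$ be $C^2$ in the sense of ultrametric calculus (it is continuous, and all difference quotients of orders $1$ and $2$ of its components extend continuously to all configurations of nodes in $\mathcal{U}_\nu$). Put $\mathcal{U}=\prod_{\nu\in S}\mathcal{U}_\nu$, $\mathbf{F}(\mathbf{x})=(\mathbf{x}_\nu,\mathbf{f}_\nu(\mathbf{x}_\nu))_{\nu\in S}\in\mathbb{Z}_S^n$ for $\mathbf{x}\in\mathcal{U}$, and $\mathcal{M}=\mathbf{F}(\mathcal{U})$. For $\tilde{\mathbf{b}}=(b_0,\dots,b_n)\in\mathbb{Z}^{n+1}$ let $\|\tilde{\mathbf{b}}\|_\infty=\max_i|b_i|$.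 For weights $\boldsymbol{\tau}=(\tau_{i,\nu})_{1\le i\le n,\,\nu\in S}$ with all $\tau_{i,\nu}>0$: * for $c>0$ let $W(c,\boldsymbol\tau)$ be the set of $\mathbf{y}\in\mathbb{Z}_S^n$ such that, for infinitely many $\tilde{\mathbf{b}}\in\mathbb{Z}^{n+1}$, $|b_0y_{i,\nu}-b_i|_\nu<c\,\|\tilde{\mathbf{b}}\|_\infty^{-\tau_{i,\nu}}$ for all $i$ and $\nu$; the set of $\boldsymbol\tau$-badly approximable points is $\mathbf{Bad}^{(S)}_n(\boldsymbol\tau)=\mathbb{Z}_S^n\setminus\bigcap_{\ell\ge1}W(1/\ell,\boldsymbol\tau)$; * for $\mathbf{y}\in\mathbb{Z}_S^n$ let $\omega_{\boldsymbol\tau}(\mathbf{y})\in[-\infty,\infty]$ be the supremum of the real $\omega$ for which $\max_{i,\nu}|b_0y_{i,\nu}+b_i|_\nu^{1/\tau_{i,\nu}}\le\|\tilde{\mathbf{b}}\|_\infty^{-\omega}$ for infinitely many $\tilde{\mathbf{b}}\in\mathbb{Z}^{n+1}$; * let $\omega_{\boldsymbol\tau}(\mathcal{M})$ be the infimum of the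 $\omega\in[-\infty,\infty]$ such that $\omega_{\boldsymbol\tau}(\mathbf{F}(\mathbf{x}))\le\omega$ for $\mu_{S,d}$-almost every $\mathbf{x}\in\mathcal{U}$. Let $\boldsymbol\tau$ be positive weights with $$\sum_{i=1}^n\sum_{\nu\in S}\tau_{i,\nu}=n+1,\qquad \min_{1\le i\le d}\tau_{i,\nu}\ge\max_{1\le j\le m}\tau_{d+j,\nu}\quad(\nu\in S),\qquad \sum_{\nu\in S}\tau_{i,\nu}>1\quad(1\le i\le n).$$ For $\nu\in S$ and $0<\alpha<\min\{1,\min_{i,\sigma}\tau_{i,\sigma}\}$ let $$\tau^{\nu,\alpha}_{i,\nu}=\frac{(\tau_{i,\nu}-\alpha)(n+1)}{n+1-n\alpha},\qquad \tau^{\nu,\alpha}_{i,\sigma}=\frac{\tau_{i,\sigma}(n+1)}{n+1-n\alpha}\quad(\sigma\in S\setminus\{\nu\}).$$ Suppose that for every $\nu\in S$ with $\min_{1\le i\le n}\tau_{i,\nu}\le1$ there is some $0<\alpha<\min_{i,\sigma}\tau_{i,\sigma}$ (necessarily $\alpha<1$) with $$\omega_{\boldsymbol\tau^{\nu,\alpha}}(\mathcal{M})<1+\frac{\alpha}{(1-\alpha)(n+1)}.$$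 Then $\mu_{S,d}\big(\mathbf{F}^{-1}(\mathbf{Bad}^{(S)}_n(\boldsymbol\tau))\big)=0$. -/

import Mathlib

open MeasureTheory

noncomputable section

namespace SArith

instance factPrime (p : Nat.Primes) : Fact (p : ℕ).Prime := ⟨p.2⟩

instance measurableSpacePadicInt (p : ℕ) [Fact p.Prime] : MeasurableSpace ℤ_[p] := borel _

instance borelSpacePadicInt (p : ℕ) [Fact p.Prime] : BorelSpace ℤ_[p] := ⟨rfl⟩

/-- `ℤ_S^n = ∏_{ν ∈ S} ℤ_ν^n` for a finite set `S` of primes. -/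
abbrev ZS (S : Finset Nat.Primes) (n : ℕ) : Type :=
  (ν : S) → Fin n → ℤ_[((ν : Nat.Primes) : ℕ)]

/-- The normalised Haar measure on `ℤ_S^n`: the product over `ν ∈ S` and over the `n` coordinates
of the Haar probability measures on `ℤ_ν`. -/
def haarS (S : Finset Nat.Primes) (n : ℕ) : Measure (ZS S n) :=
  Measure.pi fun _ => Measure.pi fun _ => Measure.addHaarMeasure ⊤

/-! ### Maps of class `C²` in ultrametric calculus

Over `ℚ_p`, being `C²` means that all difference quotients of order at most two extend
continuously to the points where increments vanish or coincide (iterated Fréchet derivatives give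
a much weaker notion). -/

section C2

variable {p : ℕ} [Fact p.Prime] {d m : ℕ}

/-- First order difference quotient of `f` in the `i`-th coordinate, with nodes
`x_i` and `x_i + h`. -/
def quot1 (f : (Fin d → ℤ_[p]) → ℤ_[p]) (i : Fin d) (x : Fin d → ℤ_[p]) (h : ℤ_[p]) : ℚ_[p] :=
  ((f (x + Pi.single i h) : ℚ_[p]) - f x) / h

/-- Second order difference quotient of `f` in the `i`-th coordinate, with nodes
`x_i`, `x_i + h`, `x_i + k`. -/
def quot2 (f : (Fin d → ℤ_[p]) → ℤ_[p]) (i : Fin d) (x : Fin d → ℤ_[p]) (h k : ℤ_[p]) : ℚ_[p] :=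
  (quot1 f i x h - quot1 f i x k) / ((h : ℚ_[p]) - k)

/-- Mixed second order difference quotient of `f` in the `i`-th and `j`-th coordinates. -/
def quotMixed (f : (Fin d → ℤ_[p]) → ℤ_[p]) (i j : Fin d) (x : Fin d → ℤ_[p])
    (h k : ℤ_[p]) : ℚ_[p] :=
  (quot1 f i (x + Pi.single j k) h - quot1 f i x h) / k

/-- The scalar function `f` is `C²` on `U`: it is continuous, and its difference quotients of
orders one and two extend continuously to all configurations of nodes in `U`. -/
def IsC2On (f : (Fin d → ℤ_[p]) → ℤ_[p]) (U : Set (Fin d → ℤ_[p])) : Prop :=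
  ContinuousOn f U ∧
  (∀ i, ∃ g : (Fin d → ℤ_[p]) × ℤ_[p] → ℚ_[p],
    ContinuousOn g {q | q.1 ∈ U ∧ q.1 + Pi.single i q.2 ∈ U} ∧
    ∀ x h, x ∈ U → x + Pi.single i h ∈ U → h ≠ 0 → g (x, h) = quot1 f i x h) ∧
  (∀ i, ∃ g : (Fin d → ℤ_[p]) × ℤ_[p] × ℤ_[p] → ℚ_[p],
    ContinuousOn g
      {q | q.1 ∈ U ∧ q.1 + Pi.single i q.2.1 ∈ U ∧ q.1 + Pi.single i q.2.2 ∈ U} ∧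
    ∀ x h k, x ∈ U → x + Pi.single i h ∈ U → x + Pi.single i k ∈ U →
      h ≠ 0 → k ≠ 0 → h ≠ k → g (x, h, k) = quot2 f i x h k) ∧
  (∀ i j, i ≠ j → ∃ g : (Fin d → ℤ_[p]) × ℤ_[p] × ℤ_[p] → ℚ_[p],
    ContinuousOn g
      {q | q.1 ∈ U ∧ q.1 + Pi.single i q.2.1 ∈ U ∧ q.1 + Pi.single j q.2.2 ∈ U ∧
        q.1 + Pi.single j q.2.2 + Pi.single i q.2.1 ∈ U} ∧
    ∀ x h k, x ∈ U → x + Pi.single i h ∈ U → x + Pi.single j k ∈ U →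
      x + Pi.single j k + Pi.single i h ∈ U →
      h ≠ 0 → k ≠ 0 → g (x, h, k) = quotMixed f i j x h k)

end C2

/-! ### Approximation -/

section Approximation

variable {S : Finset Nat.Primes} {n : ℕ}

/-- The `Ψ`-approximable points of `ℤ_S^n`: those `y` such that
`|b₀ y_{i,ν} - b_i|_ν < ψ_{i,ν}(b)` for all `i`, `ν` holds for infinitely many integer vectors
`b = (b₀, …, b_n)`. -/
def approximable (Ψ : Fin n → S → (Fin (n + 1) → ℤ) → ℝ) : Set (ZS S n) :=
  {y | {b : Fin (n + 1) → ℤ |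
    ∀ (i : Fin n) (ν : S), ‖(b 0 : ℤ_[((ν : Nat.Primes) : ℕ)]) * y ν i - b i.succ‖ < Ψ i ν b}.Infinite}

/-- The `τ`-badly approximable points of `ℤ_S^n`: those that fail to be
`ℓ⁻¹Ψ`-approximable for some `ℓ ≥ 1`, where `ψ_{i,ν}(b) = ‖b‖_∞^{-τ_{i,ν}}`.
(The norm of an integer vector is the maximum of the absolute values of its entries.)
This set contains the variant in which the points are moreover required to be
`Ψ`-approximable. -/
def Bad (τ : Fin n → S → ℝ) : Set (ZS S n) :=
  (⋂ ℓ : ℕ+, approximable fun i ν b => 1 / (ℓ : ℝ) * ‖b‖ ^ (-τ i ν))ᶜ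

/-- The weighted Diophantine exponent `ω_τ(y)` of a point. -/
def pointExponent (τ : Fin n → S → ℝ) (y : ZS S n) : EReal :=
  sSup ((fun ω : ℝ => (ω : EReal)) '' {ω : ℝ | {b : Fin (n + 1) → ℤ |
    ∀ (i : Fin n) (ν : S), ‖(b 0 : ℤ_[((ν : Nat.Primes) : ℕ)]) * y ν i + b i.succ‖ ^ (1 / τ i ν)
      ≤ 1 / ‖b‖ ^ ω}.Infinite})

/-- The weights `τ^{ν,α}`. -/
def modWeights (τ : Fin n → S → ℝ) (ν : S) (α : ℝ) : Fin n → S → ℝ := fun i σ =>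
  if σ = ν then (τ i σ - α) * (n + 1) / (n + 1 - n * α)
  else τ i σ * (n + 1) / (n + 1 - n * α)

end Approximation

/-! ### Manifolds -/

section Manifold

variable {S : Finset Nat.Primes} {d m : ℕ}

/-- The parametrisation `F(x) = (x_ν, f_ν(x_ν))_ν`. -/
def graphMap (f : (ν : S) → (Fin d → ℤ_[((ν : Nat.Primes) : ℕ)]) →
    Fin m → ℤ_[((ν : Nat.Primes) : ℕ)]) (x : ZS S d) : ZS S (d + m) :=
  fun ν => Fin.append (x ν) (f ν (x ν))

/-- The exponent `ω_τ(M)` of the manifold `M = F(U)`: the infimum of those `ω` with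
`ω_τ(F(x)) ≤ ω` for almost every `x ∈ U`. -/
def manifoldExponent (τ : Fin (d + m) → S → ℝ) (U : Set (ZS S d))
    (F : ZS S d → ZS S (d + m)) : EReal :=
  sInf {ω : EReal | ∀ᵐ x ∂haarS S d, x ∈ U → pointExponent τ (F x) ≤ ω}

end Manifold

end SArith

end

/-! The part of `U` lying over `Bad` is covered by countably many sets `E` of points having no
approximation of quality `1/ℓ` and height at least `T`. Each `E` is null by a density argument: at
almost every `x` in `E`, the set `E` nearly fills every small product box containing `x`, however
skew its sides (`ae_strong_density`). This is contradicted by boxes around `x` of which a fixed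
proportion misses `E`.

The boxes come from Dirichlet's theorem for the system linearised at `x` (`exists_large_solutions`).
The forms `b₀x_i - b_i` are allowed a large constant `C`, the tangent forms a small constant `η`;
only the product of all constants matters, because the weights sum to `n+1`. A solution `b` puts `x`
in a box centred at the points `b_i/b₀`, with sides about `C‖b‖^(-τ)/|b₀|`. Shrinking the sides by
fixed factors makes the first `d` errors at most `η‖b‖^(-τ)`. Differentiability at `x` and the
dominance of the first `d` weights carry this over to the other coordinates (`norm_tangent_le`), so
the shrunken box misses `E`.

The boxes must shrink to `x`, which requires `|b₀|_ν ≥ ‖b‖^(-α)` with `α < τ_{i,ν}`. Since `b_i` is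
close to `b₀y_i` with `y_i` integral, it is enough that some entry of `b` is that large at `ν`. If
all weights at `ν` exceed 1, powers of `ν` can be divided out of `b` without spoiling the
inequalities. Otherwise a `b` divisible by `ν^k ≈ ‖b‖^α` would make `b/ν^k` too good an
approximation for the weights `τ^{ν,α}`, against the exponent hypothesis
(`exists_norm_gt_of_pointExponent_le`). -/

noncomputable section

namespace SArith

open Filter Topology Set
open scoped ENNReal NNReal

/-! ### Density bases and their products -/

/-- A decreasing sequence of countable families of measurable sets such that almost every point of
a measurable set `E` is a density point of `E` along these families. -/
structure IsDensityBasis {X : Type*} [MeasurableSpace X] (μ : Measure X)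
    (𝓑 : ℕ → Set (Set X)) : Prop where
  antitone : Antitone 𝓑
  countable : ∀ k, (𝓑 k).Countable
  measurableSet : ∀ k, ∀ B ∈ 𝓑 k, MeasurableSet B
  density : ∀ E, MeasurableSet E → ∀ c : ℝ≥0∞, c < 1 →
    ∀ᵐ x ∂μ, x ∈ E → ∃ k, ∀ B ∈ 𝓑 k, x ∈ B → c * μ B ≤ μ (E ∩ B)

section Pi

variable {ι : Type*} [Fintype ι] {X : ι → Type*}

/-- The product boxes whose sides belong to the given families. -/
def boxBasis (𝓑 : ∀ i, ℕ → Set (Set (X i))) (k : ℕ) : Set (Set (∀ i, X i)) :=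
  Set.univ.pi '' {B | ∀ i, B i ∈ 𝓑 i k}

theorem countable_sides {𝓑 : ∀ i, ℕ → Set (Set (X i))} (h : ∀ i k, (𝓑 i k).Countable) (k : ℕ) :
    {B : ∀ i, Set (X i) | ∀ i, B i ∈ 𝓑 i k}.Countable := by
  have := Set.countable_univ_pi (s := fun i => 𝓑 i k) (fun i => h i k)
  convert this using 1
  ext B; simp

variable [∀ i, MeasurableSpace (X i)] {μ : ∀ i, Measure (X i)} [∀ i, SigmaFinite (μ i)]

/-- A measurable set in a product is null as soon as all its sections in one direction are. -/
theorem pi_null_of_sections [DecidableEq ι] (i : ι) {A : Set (∀ i, X i)} (hA : MeasurableSet A)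
    (h : ∀ x, μ i {z | Function.update x i z ∈ A} = 0) : Measure.pi μ A = 0 := by
  rcases isEmpty_or_nonempty (∀ i, X i) with h0 | ⟨⟨x⟩⟩
  · rw [Set.eq_empty_of_isEmpty A]; simp
  rw [← lintegral_indicator_one hA, lintegral_eq_lmarginal_univ x,
    lmarginal_erase' _ (measurable_one.indicator hA) (Finset.mem_univ i)]
  have : (fun x : ∀ i, X i => ∫⁻ z, A.indicator (1 : (∀ i, X i) → ℝ≥0∞) (Function.update x i z) ∂μ i) = 0 := by
    funext x
    have hm : MeasurableSet {z | Function.update x i z ∈ A} := measurable_update x hA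
    rw [Pi.zero_apply, ← h x, ← lintegral_indicator_one hm]
    rfl
  rw [this]
  simp [lmarginal]

/-- By Fubini: on each line parallel to the `i`-th axis the exceptional points are null by
one-dimensional density. Countability of the families makes the exceptional set measurable. -/
theorem ae_density_section [DecidableEq ι] {𝓑 : ∀ i, ℕ → Set (Set (X i))}
    (h𝓑 : ∀ i, IsDensityBasis (μ i) (𝓑 i)) (i : ι) {E : Set (∀ i, X i)} (hE : MeasurableSet E)
    {c : ℝ≥0∞} (hc : c < 1) :
    ∀ᵐ x ∂Measure.pi μ, x ∈ E → ∃ k, ∀ B ∈ 𝓑 i k, x i ∈ B →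
      c * μ i B ≤ μ i ({z | Function.update x i z ∈ E} ∩ B) := by
  have hmeas : Measurable fun q : (∀ i, X i) × X i => Function.update q.1 i q.2 :=
    measurable_update'.comp measurable_id
  have hset : ∀ B, MeasurableSet B → Measurable fun x : ∀ i, X i =>
      μ i ({z | Function.update x i z ∈ E} ∩ B) := fun B hB =>
    measurable_measure_prodMk_left (ν := μ i) ((hmeas hE).inter (measurable_snd hB))
  have hA : MeasurableSet (E ∩ {x | ∃ k, ∀ B ∈ 𝓑 i k, x i ∈ B →
      c * μ i B ≤ μ i ({z | Function.update x i z ∈ E} ∩ B)}ᶜ) := by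
    refine hE.inter (MeasurableSet.compl ?_)
    simp only [Set.ofPred_exists, Set.ofPred_forall]
    refine MeasurableSet.iUnion fun k => MeasurableSet.biInter ((h𝓑 i).countable k) fun B hB => ?_
    have hBm := (h𝓑 i).measurableSet k B hB
    have h1 : MeasurableSet {x : ∀ i, X i | x i ∈ B} := measurable_pi_apply i hBm
    have h2 : MeasurableSet {x : ∀ i, X i |
        c * μ i B ≤ μ i ({z | Function.update x i z ∈ E} ∩ B)} :=
      measurableSet_le measurable_const (hset B hBm)
    convert h1.compl.union h2 using 1
    ext x; simp [imp_iff_not_or]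
  have := pi_null_of_sections (μ := μ) i hA fun x => by
    have hs : MeasurableSet {z | Function.update x i z ∈ E} := measurable_update x hE
    have hd := (h𝓑 i).density _ hs c hc
    rw [ae_iff] at hd
    refine measure_mono_null ?_ hd
    rintro z ⟨hz, hz'⟩ hcon
    exact hz' (by simpa using hcon hz)
  rw [ae_iff]
  refine measure_mono_null ?_ this
  intro x hx
  simp only [Set.mem_ofPred_eq, Classical.not_imp] at hx
  exact ⟨hx.1, hx.2⟩

/-- Strong density, one direction at a time: the points that are already good in the directions `t`
form a set to which density in a new direction applies. Each direction costs a factor `c`. -/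
theorem ae_density_lmarginal [DecidableEq ι] {𝓑 : ∀ i, ℕ → Set (Set (X i))}
    (h𝓑 : ∀ i, IsDensityBasis (μ i) (𝓑 i)) {c : ℝ≥0∞} (hc : c < 1) (t : Finset ι) :
    ∀ E : Set (∀ i, X i), MeasurableSet E → ∀ᵐ x ∂Measure.pi μ, x ∈ E →
      ∃ k, ∀ B : ∀ i, Set (X i), (∀ i, B i ∈ 𝓑 i k) → (∀ i ∈ t, x i ∈ B i) →
        c ^ t.card * ∏ i ∈ t, μ i (B i) ≤
          (∫⋯∫⁻_t, (E ∩ {z | ∀ i ∈ t, z i ∈ B i}).indicator 1 ∂μ) x := by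
  induction t using Finset.induction with
  | empty =>
    intro E hE
    refine Eventually.of_forall fun x hx => ⟨0, fun B _ _ => ?_⟩
    simp [hx]
  | insert i t hi ih =>
    intro E hE
    have hbox : ∀ (s : Finset ι) (k : ℕ) (B : ∀ i, Set (X i)), (∀ i, B i ∈ 𝓑 i k) →
        MeasurableSet (E ∩ {z | ∀ i ∈ s, z i ∈ B i}) := by
      intro s k B hB
      refine hE.inter ?_
      simp only [Set.ofPred_forall]
      exact MeasurableSet.biInter s.countable_toSet fun j _ =>
        measurable_pi_apply j ((h𝓑 j).measurableSet k _ (hB j))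
    -- Points of `E` where the estimate for `t` holds from the uniform scale `k` on. Fixing `k` lets
    -- the estimate be integrated over the new coordinate.
    let G : ℕ → Set (∀ i, X i) := fun k => E ∩ {x | ∀ B ∈ {B : ∀ i, Set (X i) | ∀ i, B i ∈ 𝓑 i k},
      (∀ i ∈ t, x i ∈ B i) → c ^ t.card * ∏ i ∈ t, μ i (B i) ≤
          (∫⋯∫⁻_t, (E ∩ {z | ∀ i ∈ t, z i ∈ B i}).indicator 1 ∂μ) x}
    have hG : ∀ k, MeasurableSet (G k) := by
      intro k
      refine hE.inter ?_
      rw [show {x : ∀ i, X i | ∀ B ∈ {B : ∀ i, Set (X i) | ∀ i, B i ∈ 𝓑 i k},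
          (∀ i ∈ t, x i ∈ B i) → c ^ t.card * ∏ i ∈ t, μ i (B i) ≤
          (∫⋯∫⁻_t, (E ∩ {z | ∀ i ∈ t, z i ∈ B i}).indicator 1 ∂μ) x} =
          ⋂ B ∈ {B : ∀ i, Set (X i) | ∀ i, B i ∈ 𝓑 i k}, {x | (∀ i ∈ t, x i ∈ B i) →
          c ^ t.card * ∏ i ∈ t, μ i (B i) ≤
          (∫⋯∫⁻_t, (E ∩ {z | ∀ i ∈ t, z i ∈ B i}).indicator 1 ∂μ) x} by
        ext x; simp only [Set.mem_iInter, Set.mem_ofPred_eq]]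
      refine MeasurableSet.biInter (countable_sides (fun i => (h𝓑 i).countable) k) fun B hB => ?_
      have h1 : MeasurableSet {x : ∀ i, X i | ∀ i ∈ t, x i ∈ B i} := by
        simp only [Set.ofPred_forall]
        exact MeasurableSet.biInter t.countable_toSet fun j _ =>
          measurable_pi_apply j ((h𝓑 j).measurableSet k _ (hB j))
      have h2 : MeasurableSet {x : ∀ i, X i | c ^ t.card * ∏ i ∈ t, μ i (B i) ≤
          (∫⋯∫⁻_t, (E ∩ {z | ∀ i ∈ t, z i ∈ B i}).indicator 1 ∂μ) x} :=
        measurableSet_le measurable_const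
          (Measurable.lmarginal μ (measurable_one.indicator (hbox t k B hB)))
      convert h1.compl.union h2 using 1
      ext x
      simp only [Set.mem_ofPred_eq, Set.mem_union, Set.mem_compl_iff]
      tauto
    have hsec : ∀ᵐ x ∂Measure.pi μ, ∀ k, x ∈ G k → ∃ k', ∀ B ∈ 𝓑 i k', x i ∈ B →
        c * μ i B ≤ μ i ({z | Function.update x i z ∈ G k} ∩ B) :=
      ae_all_iff.2 fun k => ae_density_section h𝓑 i (hG k) hc
    filter_upwards [ih E hE, hsec] with x hx hxs hxE
    obtain ⟨k, hk⟩ := hx hxE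
    obtain ⟨k', hk'⟩ := hxs k ⟨hxE, hk⟩
    refine ⟨max k k', fun B hB hxB => ?_⟩
    have hBk : ∀ j, B j ∈ 𝓑 j k := fun j => (h𝓑 j).antitone (le_max_left _ _) (hB j)
    have hBk' : ∀ j, B j ∈ 𝓑 j k' := fun j => (h𝓑 j).antitone (le_max_right _ _) (hB j)
    have h1 := hk' (B i) (hBk' i) (hxB i (Finset.mem_insert_self _ _))
    rw [lmarginal_insert _ (measurable_one.indicator (hbox _ k B hBk)) hi,
      Finset.card_insert_of_notMem hi, Finset.prod_insert hi]
    have hm : MeasurableSet ({z | Function.update x i z ∈ G k} ∩ B i) :=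
      (measurable_update x (hG k)).inter ((h𝓑 i).measurableSet k _ (hBk i))
    calc c ^ (t.card + 1) * (μ i (B i) * ∏ j ∈ t, μ j (B j))
        = (c ^ t.card * ∏ j ∈ t, μ j (B j)) * (c * μ i (B i)) := by ring
      _ ≤ (c ^ t.card * ∏ j ∈ t, μ j (B j)) * μ i ({z | Function.update x i z ∈ G k} ∩ B i) := by
          gcongr
      _ = ∫⁻ z, ({z | Function.update x i z ∈ G k} ∩ B i).indicator
            (fun _ => c ^ t.card * ∏ j ∈ t, μ j (B j)) z ∂μ i := by
          rw [lintegral_indicator_const hm]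
      _ ≤ _ := by
          refine lintegral_mono fun z => ?_
          by_cases hz : z ∈ {z | Function.update x i z ∈ G k} ∩ B i
          · rw [Set.indicator_of_mem hz]
            refine (hz.1.2 B hBk fun j hj => ?_).trans ?_
            · have : j ≠ i := fun h => hi (h ▸ hj)
              simpa [this] using hxB j (Finset.mem_insert_of_mem hj)
            · rw [lmarginal_update_of_notMem (measurable_one.indicator (hbox _ k B hBk)) hi,
                lmarginal_update_of_notMem (measurable_one.indicator (hbox _ k B hBk)) hi]
              refine lmarginal_mono (fun w => ?_) x
              simp only [Function.comp]
              by_cases hw : Function.update w i z ∈ E ∩ {z | ∀ i ∈ t, z i ∈ B i}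
              · rw [Set.indicator_of_mem hw, Set.indicator_of_mem]
                refine ⟨hw.1, fun j hj => ?_⟩
                rcases Finset.mem_insert.1 hj with rfl | hj
                · simpa using hz.2
                · exact hw.2 j hj
              · rw [Set.indicator_of_notMem hw]; exact zero_le
          · rw [Set.indicator_of_notMem hz]; exact zero_le

theorem isDensityBasis_boxBasis {𝓑 : ∀ i, ℕ → Set (Set (X i))}
    (h𝓑 : ∀ i, IsDensityBasis (μ i) (𝓑 i)) :
    IsDensityBasis (Measure.pi μ) (boxBasis 𝓑) where
  antitone k l hkl := Set.image_mono fun B hB i => (h𝓑 i).antitone hkl (hB i)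
  countable k := (countable_sides (fun i => (h𝓑 i).countable) k).image _
  measurableSet := by
    rintro k _ ⟨B, hB, rfl⟩
    exact MeasurableSet.univ_pi fun i => (h𝓑 i).measurableSet k _ (hB i)
  density E hE c hc := by
    classical
    obtain ⟨c', hc', hcc⟩ : ∃ c' : ℝ≥0∞, c' < 1 ∧ c ≤ c' ^ (Finset.univ : Finset ι).card := by
      have h1 : Tendsto (fun x : ℝ≥0∞ => x ^ (Finset.univ : Finset ι).card) (𝓝[<] 1) (𝓝 1) := by
        have := (ENNReal.continuous_pow (Finset.univ : Finset ι).card).tendsto 1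
        rw [one_pow] at this
        exact this.mono_left nhdsWithin_le_nhds
      have h2 : (𝓝[<] (1 : ℝ≥0∞)).NeBot := nhdsLT_neBot_of_exists_lt ⟨0, zero_lt_one⟩
      obtain ⟨c', h, h'⟩ := ((h1.eventually (lt_mem_nhds hc)).and self_mem_nhdsWithin).exists
      exact ⟨c', h', h.le⟩
    filter_upwards [ae_density_lmarginal h𝓑 hc' Finset.univ E hE] with x hx hxE
    obtain ⟨k, hk⟩ := hx hxE
    refine ⟨k, ?_⟩
    rintro _ ⟨B, hB, rfl⟩ hxB
    have hm : MeasurableSet (E ∩ Set.univ.pi B) :=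
      hE.inter (MeasurableSet.univ_pi fun i => (h𝓑 i).measurableSet k _ (hB i))
    have := hk B hB (fun i _ => hxB i (Set.mem_univ i))
    have hs : E ∩ {z | ∀ i ∈ (Finset.univ : Finset ι), z i ∈ B i} = E ∩ Set.univ.pi B := by
      ext z; simp
    rw [hs, lmarginal_univ, lintegral_indicator_one hm] at this
    rw [Measure.pi_pi]
    exact (mul_le_mul_left hcc _).trans this

end Pi

/-! ### Balls in the `p`-adic integers -/

section PadicBalls

variable {p : ℕ} [hp : Fact p.Prime]

/-- The closed ball of radius `p ^ (-m)`. -/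
def padicBall (w : ℤ_[p]) (m : ℕ) : Set ℤ_[p] := Metric.closedBall w ((p : ℝ) ^ (-m : ℤ))

theorem mem_padicBall {w x : ℤ_[p]} {m : ℕ} :
    x ∈ padicBall w m ↔ ‖x - w‖ ≤ (p : ℝ) ^ (-m : ℤ) := by
  rw [padicBall, Metric.mem_closedBall, dist_eq_norm]

theorem padicBall_eq_of_mem {w x : ℤ_[p]} {m : ℕ} (h : x ∈ padicBall w m) :
    padicBall w m = padicBall x m :=
  (IsUltrametricDist.closedBall_eq_of_mem h)

theorem cast_prime_pos : (0 : ℝ) < p := by exact_mod_cast hp.out.pos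

theorem one_lt_cast_prime : (1 : ℝ) < p := by exact_mod_cast hp.out.one_lt

theorem padicBall_anti (w : ℤ_[p]) {m k : ℕ} (h : m ≤ k) : padicBall w k ⊆ padicBall w m :=
  Metric.closedBall_subset_closedBall (zpow_le_zpow_right₀ one_lt_cast_prime.le (by simpa using h))

theorem natCast_appr_mem_padicBall (w : ℤ_[p]) (m : ℕ) : (w.appr m : ℤ_[p]) ∈ padicBall w m := by
  rw [mem_padicBall, norm_sub_rev, PadicInt.norm_le_pow_iff_mem_span_pow]
  exact PadicInt.appr_spec m w

theorem measurableSet_padicBall (w : ℤ_[p]) (m : ℕ) : MeasurableSet (padicBall w m) :=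
  Metric.isClosed_closedBall.measurableSet

theorem haar_padicBall_pos (w : ℤ_[p]) (m : ℕ) :
    0 < (Measure.addHaarMeasure ⊤ : Measure ℤ_[p]) (padicBall w m) :=
  Metric.measure_closedBall_pos _ _ (zpow_pos cast_prime_pos _)

/-- The next `s` digits split a ball of level `m` into `p ^ s` balls of level `m + s`, all of equal
measure by translation invariance. -/
theorem haar_padicBall_le (w w' : ℤ_[p]) (m s : ℕ) :
    (Measure.addHaarMeasure ⊤ : Measure ℤ_[p]) (padicBall w m) ≤
      (p : ℝ≥0∞) ^ s * (Measure.addHaarMeasure ⊤ : Measure ℤ_[p]) (padicBall w' (m + s)) := by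
  set μ := (Measure.addHaarMeasure ⊤ : Measure ℤ_[p])
  have hsub : padicBall w m ⊆
      ⋃ a ∈ Finset.range (p ^ s), padicBall (w + (p : ℤ_[p]) ^ m * (a : ℤ_[p])) (m + s) := by
    intro x hx
    rw [mem_padicBall, PadicInt.norm_le_pow_iff_mem_span_pow, Ideal.mem_span_singleton] at hx
    obtain ⟨u, hu⟩ := hx
    simp only [Set.mem_iUnion, Finset.mem_range]
    refine ⟨u.appr s, PadicInt.appr_lt u s, ?_⟩
    rw [mem_padicBall, PadicInt.norm_le_pow_iff_mem_span_pow, Ideal.mem_span_singleton, pow_add]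
    have := PadicInt.appr_spec s u
    rw [Ideal.mem_span_singleton] at this
    obtain ⟨v, hv⟩ := this
    exact ⟨v, by linear_combination hu + (p : ℤ_[p]) ^ m * hv⟩
  have htr : ∀ z, μ (padicBall z (m + s)) = μ (padicBall w' (m + s)) := by
    intro z
    have : padicBall z (m + s) = (fun x => (w' - z) + x) ⁻¹' padicBall w' (m + s) := by
      ext x
      rw [Set.mem_preimage, mem_padicBall, mem_padicBall]
      congr! 2
      ring
    rw [this, measure_preimage_add]
  calc μ (padicBall w m) ≤ _ := measure_mono hsub
    _ ≤ ∑ a ∈ Finset.range (p ^ s), μ (padicBall (w + (p : ℤ_[p]) ^ m * (a : ℤ_[p])) (m + s)) :=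
      measure_biUnion_finset_le _ _
    _ = _ := by simp [htr]

theorem exists_padicBall_radius {r : ℝ} (h0 : 0 < r) (h1 : r ≤ 1) :
    ∃ m : ℕ, (p : ℝ) ^ (-m - 1 : ℤ) < r ∧ r ≤ (p : ℝ) ^ (-m : ℤ) := by
  obtain ⟨m, hm, hm'⟩ := exists_nat_pow_near (one_le_inv₀ h0 |>.2 h1) (one_lt_cast_prime (p := p))
  have hp0 := cast_prime_pos (p := p)
  refine ⟨m, ?_, ?_⟩
  · rw [show (-m - 1 : ℤ) = -((m + 1 : ℕ) : ℤ) by push_cast; ring, zpow_neg, zpow_natCast]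
    exact inv_lt_of_inv_lt₀ h0 hm'
  · rw [zpow_neg, zpow_natCast]
    exact (le_inv_comm₀ (pow_pos hp0 _) h0).1 hm

instance isUnifLocDoublingMeasure_haar :
    IsUnifLocDoublingMeasure (Measure.addHaarMeasure ⊤ : Measure ℤ_[p]) where
  exists_measure_closedBall_le_mul'' := by
    refine ⟨(p : ℝ≥0) ^ 3, ?_⟩
    filter_upwards [Ioc_mem_nhdsGT (zero_lt_one' ℝ)] with ε hε x
    obtain ⟨m, hm, hm'⟩ := exists_padicBall_radius (p := p) hε.1 hε.2
    have hp2 : (2 : ℝ) ≤ p := by exact_mod_cast hp.out.two_le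
    have hp0 := cast_prime_pos (p := p)
    -- Since `2 ≤ p`, doubling the radius costs at most one level. The truncated difference is `m -
    -- 1`, or level `0`, the whole ring, when `m = 0`.
    have h1 : Metric.closedBall x (2 * ε) ⊆ padicBall x (m + 1 - 2) := by
      rcases le_total 2 (m + 1) with h | h
      · refine Metric.closedBall_subset_closedBall ?_
        rw [show (-((m + 1 - 2 : ℕ) : ℤ)) = 1 + -m by omega, zpow_add₀ hp0.ne', zpow_one]
        exact mul_le_mul hp2 hm' hε.1.le hp0.le
      · intro y _
        rw [mem_padicBall, Nat.sub_eq_zero_of_le h]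
        simpa using PadicInt.norm_le_one _
    have h2 : padicBall x (m + 1 - 2 + 3) ⊆ Metric.closedBall x ε := by
      refine Metric.closedBall_subset_closedBall (le_trans ?_ hm.le)
      exact zpow_le_zpow_right₀ one_lt_cast_prime.le (by omega)
    calc _ ≤ _ := measure_mono h1
      _ ≤ _ := haar_padicBall_le x x _ 3
      _ ≤ _ := by
        rw [ENNReal.coe_pow, ENNReal.coe_natCast]
        gcongr

/-- The balls of radius at most `p ^ (-k)`. -/
def padicBasis (p : ℕ) [Fact p.Prime] (k : ℕ) : Set (Set ℤ_[p]) :=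
  {B | ∃ m ≥ k, ∃ w, B = padicBall w m}

theorem isDensityBasis_padicBasis :
    IsDensityBasis (Measure.addHaarMeasure ⊤ : Measure ℤ_[p]) (padicBasis p) where
  antitone k l hkl := by
    rintro B ⟨m, hm, w, rfl⟩
    exact ⟨m, hkl.trans hm, w, rfl⟩
  countable k := by
    refine (Set.countable_range fun q : ℕ × ℕ => padicBall (q.1 : ℤ_[p]) q.2).mono ?_
    rintro B ⟨m, hm, w, rfl⟩
    exact ⟨(w.appr m, m), (padicBall_eq_of_mem (natCast_appr_mem_padicBall w m)).symm⟩
  measurableSet := by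
    rintro k B ⟨m, hm, w, rfl⟩
    exact measurableSet_padicBall w m
  density E hE c hc := by
    have h := IsUnifLocDoublingMeasure.ae_tendsto_measure_inter_div
      (Measure.addHaarMeasure ⊤ : Measure ℤ_[p]) E 1
    rw [ae_restrict_iff' hE] at h
    filter_upwards [h] with x hx hxE
    have hlim : Tendsto (fun m : ℕ => (p : ℝ) ^ (-m : ℤ)) atTop (𝓝[>] 0) := by
      refine tendsto_nhdsWithin_iff.2 ⟨?_, Eventually.of_forall fun m => zpow_pos cast_prime_pos _⟩
      simp only [zpow_neg, zpow_natCast, ← inv_pow]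
      exact tendsto_pow_atTop_nhds_zero_of_lt_one (by positivity)
        (inv_lt_one_of_one_lt₀ one_lt_cast_prime)
    have h2 := hx hxE (fun _ => x) _ hlim (Eventually.of_forall fun m => by
      simp)
    obtain ⟨k, hk⟩ := eventually_atTop.1 (h2.eventually (lt_mem_nhds hc))
    refine ⟨k, ?_⟩
    rintro B ⟨m, hm, w, rfl⟩ hxB
    -- An ultrametric ball is centred at each of its points, so balls merely containing `x` reduce
    -- to balls around `x`.
    rw [padicBall_eq_of_mem hxB]
    exact ENNReal.mul_le_of_le_div (hk m hm).le

end PadicBalls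

/-! ### Integer solutions of systems of `S`-adic linear inequalities -/

section Dirichlet

/-- Pigeonhole on the box `{0, …, Q}^N`: two of its points have the same image, and their difference
is the required vector. -/
theorem exists_ne_zero_of_card_lt {N : ℕ} {G : Type*} [AddCommGroup G] [Fintype G]
    (Φ : (Fin N → ℤ) →+ G) (Q : ℕ) (h : Fintype.card G < (Q + 1) ^ N) :
    ∃ b : Fin N → ℤ, b ≠ 0 ∧ ‖b‖ ≤ Q ∧ Φ b = 0 := by
  obtain ⟨g, g', hne, heq⟩ := Fintype.exists_ne_map_eq_of_card_lt
    (fun g : Fin N → Fin (Q + 1) => Φ fun i => ((g i : ℕ) : ℤ)) (by simpa using h)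
  refine ⟨(fun i => ((g i : ℕ) : ℤ)) - fun i => ((g' i : ℕ) : ℤ), ?_, ?_, ?_⟩
  · intro h0
    apply hne
    funext i
    have := congrFun h0 i
    simp only [Pi.sub_apply, Pi.zero_apply] at this
    exact Fin.ext (by omega)
  · refine (pi_norm_le_iff_of_nonneg (Nat.cast_nonneg Q)).2 fun i => ?_
    have h1 : |((g i : ℕ) : ℤ) - ((g' i : ℕ) : ℤ)| ≤ (Q : ℤ) := by
      have := (g i).2
      have := (g' i).2
      rw [abs_le]; omega
    rw [Pi.sub_apply, Int.norm_eq_abs]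
    exact_mod_cast h1
  · rw [map_sub, sub_eq_zero]
    exact heq

/-- The value of a `p`-adic linear form at an integer vector. -/
def formVal {p : ℕ} [Fact p.Prime] {N : ℕ} (a : Fin N → ℤ_[p]) (b : Fin N → ℤ) : ℤ_[p] :=
  ∑ j, a j * (b j : ℤ_[p])

theorem formVal_natCast_mul {p : ℕ} [Fact p.Prime] {N : ℕ} (a : Fin N → ℤ_[p]) (M : ℕ)
    (b : Fin N → ℤ) : formVal a (fun j => (M : ℤ) * b j) = (M : ℤ_[p]) * formVal a b := by
  simp only [formVal, Finset.mul_sum]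
  refine Finset.sum_congr rfl fun j _ => ?_
  push_cast; ring

theorem exists_formVal_le {κ : Type*} [Fintype κ] (P : κ → ℕ) [∀ i, Fact (P i).Prime] {N : ℕ}
    (a : ∀ i, Fin N → ℤ_[P i]) (k : κ → ℕ) (Q : ℕ) (h : ∏ i, P i ^ k i < (Q + 1) ^ N) :
    ∃ b : Fin N → ℤ, b ≠ 0 ∧ ‖b‖ ≤ Q ∧ ∀ i, ‖formVal (a i) b‖ ≤ (P i : ℝ) ^ (-k i : ℤ) := by
  classical
  have : ∀ i, NeZero (P i ^ k i) := fun i => ⟨(pow_pos (Fact.out : (P i).Prime).pos _).ne'⟩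
  let Φ : (Fin N → ℤ) →+ (∀ i, ZMod (P i ^ k i)) :=
    { toFun := fun b i => PadicInt.toZModPow (k i) (formVal (a i) b)
      map_zero' := by funext i; simp [formVal]
      map_add' := fun b b' => by
        funext i
        simp [formVal, mul_add, Finset.sum_add_distrib] }
  obtain ⟨b, hb, hbQ, hΦ⟩ := exists_ne_zero_of_card_lt Φ Q (by
    rw [Fintype.card_pi]; simpa [ZMod.card] using h)
  refine ⟨b, hb, hbQ, fun i => ?_⟩
  rw [PadicInt.norm_le_pow_iff_mem_span_pow, ← PadicInt.ker_toZModPow, RingHom.mem_ker]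
  exact congrFun hΦ i

/-- A weighted form of Dirichlet's theorem. -/
theorem eventually_exists_formVal_le {κ : Type*} [Fintype κ] (P : κ → ℕ) [∀ i, Fact (P i).Prime]
    {N : ℕ} (a : ∀ i, Fin N → ℤ_[P i]) (τ c : κ → ℝ) (hτ : ∀ i, 0 < τ i) (hc : ∀ i, 0 < c i)
    (hsum : ∑ i, τ i = N) (hN : N ≠ 0) (hprod : ∏ i, (P i : ℝ) ≤ ∏ i, c i) :
    ∀ᶠ Q : ℕ in atTop, ∃ b : Fin N → ℤ, b ≠ 0 ∧ ‖b‖ ≤ Q ∧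
      ∀ i, ‖formVal (a i) b‖ ≤ c i * (Q : ℝ) ^ (-τ i) := by
  have hlarge : ∀ᶠ Q : ℕ in atTop, ∀ i, c i ≤ (Q : ℝ) ^ τ i :=
    eventually_all.2 fun i =>
      ((tendsto_rpow_atTop (hτ i)).comp tendsto_natCast_atTop_atTop).eventually_ge_atTop (c i)
  filter_upwards [hlarge, eventually_gt_atTop 0] with Q hQ hQ0
  have hQ0' : (0 : ℝ) < Q := by exact_mod_cast hQ0
  -- Rounding up to a power of `P i` loses at most a factor `P i`; `hprod` compensates for the total
  -- loss.
  have hk : ∀ i, ∃ k : ℕ, ((P i : ℝ) ^ k ≤ P i * ((Q : ℝ) ^ τ i / c i)) ∧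
      (Q : ℝ) ^ τ i / c i < (P i : ℝ) ^ k := by
    intro i
    have h1 : 1 ≤ (Q : ℝ) ^ τ i / c i := (one_le_div (hc i)).2 (hQ i)
    obtain ⟨k, hk, hk'⟩ := exists_nat_pow_near h1 (one_lt_cast_prime (p := P i))
    refine ⟨k + 1, ?_, hk'⟩
    rw [pow_succ']
    exact mul_le_mul_of_nonneg_left hk cast_prime_pos.le
  choose k hk hk' using hk
  have hcard : ∏ i, P i ^ k i < (Q + 1) ^ N := by
    have h1 : ∏ i, (P i : ℝ) ^ k i ≤ (Q : ℝ) ^ N := by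
      calc ∏ i, (P i : ℝ) ^ k i ≤ ∏ i, (P i * ((Q : ℝ) ^ τ i / c i)) :=
            Finset.prod_le_prod (fun i _ => by positivity) fun i _ => hk i
        _ = (∏ i, (P i : ℝ)) / (∏ i, c i) * (Q : ℝ) ^ (N : ℝ) := by
            rw [Finset.prod_mul_distrib, Finset.prod_div_distrib, ← hsum,
              Real.rpow_sum_of_pos hQ0']
            ring
        _ ≤ 1 * (Q : ℝ) ^ (N : ℝ) := by
            gcongr
            exact (div_le_one (Finset.prod_pos fun i _ => hc i)).2 hprod
        _ = _ := by rw [one_mul, Real.rpow_natCast]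
    have h2 : ∏ i, P i ^ k i ≤ Q ^ N := by exact_mod_cast h1
    exact h2.trans_lt (Nat.pow_lt_pow_left (Nat.lt_succ_self Q) hN)
  obtain ⟨b, hb, hbQ, hbk⟩ := exists_formVal_le P a k Q hcard
  refine ⟨b, hb, hbQ, fun i => (hbk i).trans ?_⟩
  rw [zpow_neg, zpow_natCast, Real.rpow_neg hQ0'.le, ← div_eq_mul_inv]
  rw [← inv_div]
  exact inv_anti₀ (div_pos (Real.rpow_pos_of_pos hQ0' _) (hc i)) (hk' i).le

theorem finite_norm_lt {N : ℕ} (T : ℝ) : {b : Fin N → ℤ | ‖b‖ < T}.Finite := by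
  have := (isCompact_closedBall (0 : Fin N → ℤ) T).finite_of_discrete
  refine this.subset fun b hb => ?_
  simpa using (le_of_lt hb)

theorem one_le_norm_of_ne_zero {N : ℕ} {b : Fin N → ℤ} (hb : b ≠ 0) : 1 ≤ ‖b‖ := by
  obtain ⟨i, hi⟩ := Function.ne_iff.1 hb
  refine le_trans ?_ (norm_le_pi_norm b i)
  rw [Int.norm_eq_abs]
  exact_mod_cast Int.one_le_abs hi

theorem norm_natCast_mul {N : ℕ} (M : ℕ) (b : Fin N → ℤ) :
    ‖(fun j => (M : ℤ) * b j)‖ = M * ‖b‖ := by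
  have : (fun j => (M : ℤ) * b j) = (M : ℤ) • b := by ext j; simp
  rw [this, norm_smul, Int.norm_natCast]

theorem inv_le_norm_natCast {p : ℕ} [hp : Fact p.Prime] {M : ℕ} (hM : M ≠ 0) :
    (M : ℝ)⁻¹ ≤ ‖(M : ℤ_[p])‖ := by
  have hM' : (M : ℤ_[p]) ≠ 0 := by exact_mod_cast hM
  rw [PadicInt.norm_eq_zpow_neg_valuation hM', zpow_neg, zpow_natCast]
  have h1 : p ^ (M : ℤ_[p]).valuation ∣ M := by
    have h := (PadicInt.norm_int_le_pow_iff_dvd (p := p) (k := (M : ℤ))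
      (n := (M : ℤ_[p]).valuation)).1
      (by rw [Int.cast_natCast, PadicInt.norm_eq_zpow_neg_valuation hM'])
    exact_mod_cast h
  refine inv_anti₀ (pow_pos cast_prime_pos _) ?_
  exact_mod_cast Nat.le_of_dvd (Nat.pos_of_ne_zero hM) h1

/-- One can divide out of a nonzero integer vector all the primes in `A`, without changing its
`p`-adic size for the primes outside `A`. -/
theorem exists_primitive_part {κ : Type*} (P : κ → ℕ) [∀ i, Fact (P i).Prime] (A : Set κ)
    (hA : ∀ i ∈ A, ∀ j ∉ A, P i ≠ P j) {N : ℕ} {b : Fin N → ℤ} (hb : b ≠ 0) :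
    ∃ (M : ℕ) (b' : Fin N → ℤ), M ≠ 0 ∧ b' ≠ 0 ∧ b = (fun j => (M : ℤ) * b' j) ∧
      (∀ i ∉ A, ‖(M : ℤ_[P i])‖ = 1) ∧ ∀ i ∈ A, ∃ j, ‖(b' j : ℤ_[P i])‖ = 1 := by
  -- The largest `M` in this set works: a prime of `A` dividing every entry of the quotient could be
  -- moved into `M`.
  let T : Set ℕ := {M | M ≠ 0 ∧ (∃ b' : Fin N → ℤ, b = fun j => (M : ℤ) * b' j) ∧
    ∀ i ∉ A, ‖(M : ℤ_[P i])‖ = 1}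
  have hne : T.Nonempty := ⟨1, one_ne_zero, ⟨b, by simp⟩, fun i _ => by simp⟩
  have hnz : ∀ (M : ℕ) (b' : Fin N → ℤ), (b = fun j => (M : ℤ) * b' j) → b' ≠ 0 := by
    rintro M b' h rfl
    exact hb (by rw [h]; funext j; simp)
  have hbd : BddAbove T := by
    obtain ⟨L, hL⟩ := exists_nat_ge ‖b‖
    refine ⟨L, ?_⟩
    rintro M ⟨-, ⟨b', hb'⟩, -⟩
    have h1 := one_le_norm_of_ne_zero (hnz M b' hb')
    rw [hb', norm_natCast_mul] at hL
    have : (M : ℝ) ≤ L := by nlinarith [Nat.cast_nonneg (α := ℝ) M]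
    exact_mod_cast this
  obtain ⟨h0, ⟨b', hb'⟩, hM⟩ := Nat.sSup_mem hne hbd
  refine ⟨sSup T, b', h0, hnz _ _ hb', hb', hM, fun i hi => ?_⟩
  by_contra! hcon
  have hdvd : ∀ j, ∃ z, b' j = (P i : ℤ) * z := fun j =>
    (PadicInt.norm_int_lt_one_iff_dvd (b' j)).1 (lt_of_le_of_ne (PadicInt.norm_le_one _) (hcon j))
  choose z hz using hdvd
  have hmem : sSup T * P i ∈ T := by
    refine ⟨mul_ne_zero h0 (Fact.out : (P i).Prime).ne_zero, ⟨z, ?_⟩, fun j hj => ?_⟩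
    · rw [hb']; funext j; rw [hz j]; push_cast; ring
    · rw [Nat.cast_mul, norm_mul, hM j hj, one_mul, PadicInt.norm_natCast_eq_one_iff]
      exact (Nat.coprime_primes Fact.out Fact.out).2 (hA i hi j hj).symm
  have h1 := le_csSup hbd hmem
  have h2 := (Fact.out : (P i).Prime).one_lt
  nlinarith [Nat.pos_of_ne_zero h0]

/-- Apply Dirichlet for every `Q` and pass to primitive parts. Dividing by `M` multiplies a form by
at most `M` at the places of `A`, harmless since `M · M^(-τ) ≤ 1` there. If the primitive parts stay
bounded, finitely many vectors serve all large `Q`, so the forms vanish at one of them. -/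
theorem exists_formVal_eq_zero_or_unbounded {κ : Type*} [Fintype κ] (P : κ → ℕ)
    [∀ i, Fact (P i).Prime] {N : ℕ} (a : ∀ i, Fin N → ℤ_[P i]) (τ c : κ → ℝ) (hτ : ∀ i, 0 < τ i)
    (hc : ∀ i, 0 < c i) (hsum : ∑ i, τ i = N) (hN : N ≠ 0) (hprod : ∏ i, (P i : ℝ) ≤ ∏ i, c i)
    (A : Set κ) (hA : ∀ i ∈ A, ∀ j ∉ A, P i ≠ P j) (hτA : ∀ i ∈ A, 1 < τ i) :
    (∃ b : Fin N → ℤ, b ≠ 0 ∧ ∀ i, formVal (a i) b = 0) ∨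
    ∀ T : ℝ, ∃ b : Fin N → ℤ, b ≠ 0 ∧ T ≤ ‖b‖ ∧
      (∀ i, ‖formVal (a i) b‖ ≤ c i * ‖b‖ ^ (-τ i)) ∧
      ∀ i ∈ A, ∃ j, ‖(b j : ℤ_[P i])‖ = 1 := by
  classical
  rw [or_iff_not_imp_right]
  intro hcon
  push Not at hcon
  obtain ⟨T, hT⟩ := hcon
  -- In terms of `Q`, the loss of a factor `M ≤ Q` leaves the bound `c Q^(1-τ)` on `A`, which still
  -- tends to zero.
  let τ' : κ → ℝ := fun i => if i ∈ A then τ i - 1 else τ i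
  have hτ' : ∀ i, 0 < τ' i := by
    intro i
    by_cases hi : i ∈ A
    · simpa [τ', hi] using hτA i hi
    · simpa [τ', hi] using hτ i
  have hev : ∀ᶠ Q : ℕ in atTop, ∃ b ∈ {b : Fin N → ℤ | ‖b‖ < T}, b ≠ 0 ∧
      ∀ i, ‖formVal (a i) b‖ ≤ c i * (Q : ℝ) ^ (-τ' i) := by
    filter_upwards [eventually_exists_formVal_le P a τ c hτ hc hsum hN hprod,
      eventually_gt_atTop 0] with Q ⟨b, hb, hbQ, hbf⟩ hQ
    obtain ⟨M, b', hM, hb', rfl, hMA, hprim⟩ := exists_primitive_part P A hA hb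
    have hQ0 : (0 : ℝ) < Q := by exact_mod_cast hQ
    have hM0 : (0 : ℝ) < M := by exact_mod_cast Nat.pos_of_ne_zero hM
    have hb1 := one_le_norm_of_ne_zero hb'
    have hb0 : 0 < ‖b'‖ := zero_lt_one.trans_le hb1
    rw [norm_natCast_mul] at hbQ
    have hMQ : (M : ℝ) ≤ Q := by nlinarith
    have hform : ∀ i, ‖(M : ℤ_[P i])‖ * ‖formVal (a i) b'‖ ≤ c i * (Q : ℝ) ^ (-τ i) := by
      intro i
      have := hbf i
      rwa [formVal_natCast_mul, norm_mul] at this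
    have hformA : ∀ i, ‖formVal (a i) b'‖ ≤ M * (c i * (Q : ℝ) ^ (-τ i)) := by
      intro i
      have h1 := (mul_le_mul_of_nonneg_right (inv_le_norm_natCast (p := P i) hM)
        (norm_nonneg (formVal (a i) b'))).trans (hform i)
      rwa [inv_mul_le_iff₀ hM0] at h1
    have hformA' : ∀ i ∉ A, ‖formVal (a i) b'‖ ≤ c i * (Q : ℝ) ^ (-τ i) := by
      intro i hi
      simpa [hMA i hi] using hform i
    refine ⟨b', ?_, hb', fun i => ?_⟩
    · by_contra hlt
      replace hlt := not_lt.1 hlt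
      obtain ⟨i, hi, hj⟩ := hT b' hb' hlt fun i => by
        by_cases hi : i ∈ A
        · refine (hformA i).trans ?_
          rw [mul_left_comm]
          refine mul_le_mul_of_nonneg_left ?_ (hc i).le
          calc (M : ℝ) * (Q : ℝ) ^ (-τ i) ≤ M * (M * ‖b'‖) ^ (-τ i) := by
                refine mul_le_mul_of_nonneg_left ?_ hM0.le
                exact Real.rpow_le_rpow_of_nonpos (by positivity) hbQ (by linarith [hτ i])
            _ = (M : ℝ) ^ (1 + -τ i) * ‖b'‖ ^ (-τ i) := by
                rw [Real.mul_rpow hM0.le hb0.le, Real.rpow_add hM0, Real.rpow_one]; ring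
            _ ≤ 1 * ‖b'‖ ^ (-τ i) := by
                refine mul_le_mul_of_nonneg_right ?_ (Real.rpow_nonneg hb0.le _)
                refine Real.rpow_le_one_of_one_le_of_nonpos ?_ (by linarith [hτA i hi])
                exact_mod_cast Nat.one_le_iff_ne_zero.2 hM
            _ = _ := one_mul _
        · refine (hformA' i hi).trans (mul_le_mul_of_nonneg_left ?_ (hc i).le)
          refine Real.rpow_le_rpow_of_nonpos hb0 ?_ (by linarith [hτ i])
          have : (1 : ℝ) ≤ M := by exact_mod_cast Nat.one_le_iff_ne_zero.2 hM
          nlinarith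
      obtain ⟨j, hj'⟩ := hprim i hi
      exact hj j hj'
    · by_cases hi : i ∈ A
      · refine (hformA i).trans ?_
        rw [mul_left_comm]
        refine mul_le_mul_of_nonneg_left ?_ (hc i).le
        simp only [τ', if_pos hi]
        rw [show -(τ i - 1) = 1 + -τ i by ring, Real.rpow_add hQ0, Real.rpow_one]
        exact mul_le_mul_of_nonneg_right hMQ (Real.rpow_nonneg hQ0.le _)
      · simpa only [τ', if_neg hi] using hformA' i hi
  by_contra! hno
  have hall : ∀ b ∈ {b : Fin N → ℤ | ‖b‖ < T}, ∀ᶠ Q : ℕ in atTop, ¬ (b ≠ 0 ∧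
      ∀ i, ‖formVal (a i) b‖ ≤ c i * (Q : ℝ) ^ (-τ' i)) := by
    intro b _
    by_cases hb : b = 0
    · simp [hb]
    obtain ⟨i, hi⟩ := hno b hb
    have hlim : Tendsto (fun Q : ℕ => c i * (Q : ℝ) ^ (-τ' i)) atTop (𝓝 0) := by
      simpa using ((tendsto_rpow_neg_atTop (hτ' i)).comp tendsto_natCast_atTop_atTop).const_mul (c i)
    filter_upwards [hlim.eventually (gt_mem_nhds (norm_pos_iff.2 hi))] with Q hQ h
    exact absurd (h.2 i) (not_le.2 hQ)
  obtain ⟨Q, h1, b, hb, h2⟩ := (((finite_norm_lt T).eventually_all.2 hall).and hev).exists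
  exact h1 b hb h2

end Dirichlet

/-! ### Bounds on the denominator coming from Diophantine exponents -/

section Exponent

variable {S : Finset Nat.Primes} {n : ℕ}

/-- Change the sign of all coordinates but the first one. -/
def negTail (b : Fin (n + 1) → ℤ) : Fin (n + 1) → ℤ := fun j => if j = 0 then b j else -b j

theorem norm_negTail (b : Fin (n + 1) → ℤ) : ‖negTail b‖ = ‖b‖ := by
  rw [Pi.norm_def, Pi.norm_def]
  congr 2
  funext j
  unfold negTail
  split_ifs <;> simp

theorem finite_of_pointExponent_lt {τ : Fin n → S → ℝ} {y : ZS S n} {ω : ℝ}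
    (h : pointExponent τ y < ω) : {b : Fin (n + 1) → ℤ |
      ∀ (i : Fin n) (ν : S), ‖(b 0 : ℤ_[((ν : Nat.Primes) : ℕ)]) * y ν i + b i.succ‖ ^ (1 / τ i ν)
      ≤ 1 / ‖b‖ ^ ω}.Finite := by
  by_contra hinf
  have hle : (ω : EReal) ≤ pointExponent τ y := le_sSup (Set.mem_image_of_mem _ hinf)
  exact absurd hle (not_le.2 h)

theorem eventually_const_mul_rpow_le {C K a e : ℝ} (hK : 0 < K) (h : a < e) :
    ∀ᶠ t : ℝ in atTop, C * t ^ (-e) ≤ K * t ^ (-a) := by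
  have hlim : Tendsto (fun t : ℝ => C * t ^ (-(e - a))) atTop (𝓝 0) := by
    simpa using (tendsto_rpow_neg_atTop (sub_pos.2 h)).const_mul C
  filter_upwards [hlim.eventually (gt_mem_nhds hK), eventually_gt_atTop 0] with t ht ht0
  rw [show -e = -(e - a) + -a by ring, Real.rpow_add ht0, ← mul_assoc]
  exact mul_le_mul_of_nonneg_right ht.le (Real.rpow_nonneg ht0.le _)

theorem norm_primes_natCast_eq_one {σ ν : S} (h : σ ≠ ν) (k : ℕ) :
    ‖((((ν : Nat.Primes) : ℕ) : ℤ_[((σ : Nat.Primes) : ℕ)])) ^ k‖ = 1 := by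
  rw [norm_pow, PadicInt.norm_natCast_eq_one_iff.2, one_pow]
  refine (Nat.coprime_primes σ.1.2 ν.1.2).2 fun h' => h ?_
  exact Subtype.ext (Subtype.ext h')

/-- If all entries were at most `‖b‖^(-α)` at `ν`, then `b = ν^k z` with `‖z‖ ≍ ‖b‖^(1-α)`. Division
by `ν^k` worsens the errors at `ν` by at most `‖b‖^α` and leaves those at other places unchanged, so
`z` lies in the finite set of solutions for an exponent above `ω`. -/
theorem exists_norm_gt_of_pointExponent_le {τ : Fin n → S → ℝ} {ν : S} {α : ℝ} (h0 : 0 < α)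
    (h1 : α < 1) (hα : ∀ i σ, α < τ i σ) {y : ZS S n} {ω : EReal}
    (hω : ω < ((1 + α / ((1 - α) * ((n : ℝ) + 1)) : ℝ) : EReal))
    (hy : pointExponent (modWeights τ ν α) y ≤ ω) (C : ℝ) :
    ∀ᶠ t : ℝ in atTop, ∀ b : Fin (n + 1) → ℤ, ‖b‖ = t →
      (∀ i (σ : S), ‖(b 0 : ℤ_[((σ : Nat.Primes) : ℕ)]) * y σ i - b i.succ‖ ≤ C * ‖b‖ ^ (-τ i σ)) →
      ∃ j, ‖b‖ ^ (-α) < ‖(b j : ℤ_[((ν : Nat.Primes) : ℕ)])‖ := by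
  set P : ℕ := ((ν : Nat.Primes) : ℕ) with hP
  have hn : (0 : ℝ) < (n : ℝ) + 1 := by positivity
  have h1α : 0 < 1 - α := by linarith
  have hD : (0 : ℝ) < n + 1 - n * α := by nlinarith [Nat.cast_nonneg (α := ℝ) n]
  have hω0 : (0 : ℝ) < 1 + α / ((1 - α) * ((n : ℝ) + 1)) := by positivity
  -- The gap between `ω'` and the threshold absorbs the constants `C` and `P`; positivity of `ω'`
  -- makes the exponents of `‖z‖` below negative.
  obtain ⟨ω', hω', hω'0⟩ := EReal.lt_iff_exists_real_btwn.1
    (max_lt hω (show ((0 : ℝ) : EReal) < _ from EReal.coe_lt_coe_iff.2 hω0))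
  rw [max_lt_iff, EReal.coe_lt_coe_iff] at hω'
  rw [EReal.coe_lt_coe_iff] at hω'0
  have hω'pos : 0 < ω' := hω'.2
  have hfin := finite_of_pointExponent_lt (hy.trans_lt hω'.1)
  set F := {b : Fin (n + 1) → ℤ | ∀ (i : Fin n) (σ : S),
    ‖(b 0 : ℤ_[((σ : Nat.Primes) : ℕ)]) * y σ i + b i.succ‖ ^ (1 / modWeights τ ν α i σ)
      ≤ 1 / ‖b‖ ^ ω'} with hF
  obtain ⟨R, hR⟩ := (hfin.image fun b => ‖b‖).bddAbove
  let e : Fin n → S → ℝ := fun i σ => if σ = ν then τ i σ - α else τ i σ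
  have he : ∀ i σ, 0 < e i σ := by
    intro i σ
    have := hα i σ
    simp only [e]; split_ifs <;> linarith
  have hmod : ∀ i σ, modWeights τ ν α i σ = e i σ * (n + 1) / (n + 1 - n * α) := by
    intro i σ
    simp only [modWeights, e]; split_ifs <;> rfl
  have hmodpos : ∀ i σ, 0 < modWeights τ ν α i σ := fun i σ => by
    rw [hmod]; have := he i σ; positivity
  have hexp : ∀ i σ, (1 - α) * (ω' * modWeights τ ν α i σ) < e i σ := by
    intro i σ
    -- The threshold is exactly the exponent for which height `‖b‖^(1-α)` corresponds to errors
    -- `‖b‖^(-e)`.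
    have hone : (1 - α) * ((1 + α / ((1 - α) * ((n : ℝ) + 1))) * modWeights τ ν α i σ) = e i σ := by
      have h : 1 + α / ((1 - α) * ((n : ℝ) + 1)) = (n + 1 - n * α) / ((1 - α) * (n + 1)) := by
        rw [eq_div_iff (by positivity), add_mul, div_mul_cancel₀ _ (by positivity)]
        ring
      rw [hmod, h, div_mul_div_comm, ← mul_div_assoc, div_eq_iff (by positivity)]
      ring
    rw [← hone]
    have := hmodpos i σ
    gcongr
  have hP0 : (0 : ℝ) < P := cast_prime_pos
  have hlarge : ∀ᶠ t : ℝ in atTop, ∀ i σ, C * t ^ (-e i σ) ≤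
      (P : ℝ) ^ (-(ω' * modWeights τ ν α i σ)) * t ^ (-((1 - α) * (ω' * modWeights τ ν α i σ))) :=
    eventually_all.2 fun i => eventually_all.2 fun σ =>
      eventually_const_mul_rpow_le (Real.rpow_pos_of_pos hP0 _) (hexp i σ)
  filter_upwards [hlarge, eventually_ge_atTop 1,
    (tendsto_rpow_atTop h1α).eventually_gt_atTop R] with t ht ht1 htR
  rintro b rfl hb
  by_contra! hcon
  have ht0 : 0 < ‖b‖ := by linarith
  obtain ⟨k, hk, hk'⟩ := exists_nat_pow_near (Real.one_le_rpow ht1 h0.le)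
    (one_lt_cast_prime (p := P))
  have hdvd : ∀ j, ∃ z, b j = ((P ^ k : ℕ) : ℤ) * z := by
    intro j
    have : ‖(b j : ℤ_[P])‖ ≤ (P : ℝ) ^ (-k : ℤ) := by
      refine (hcon j).trans ?_
      rw [Real.rpow_neg ht0.le, zpow_neg, zpow_natCast]
      exact inv_anti₀ (pow_pos hP0 _) hk
    have h := PadicInt.norm_int_le_pow_iff_dvd.1 this
    exact_mod_cast h
  choose z hz using hdvd
  have hbz : b = fun j => ((P ^ k : ℕ) : ℤ) * z j := funext hz
  have hnorm : ‖b‖ = (P : ℝ) ^ k * ‖z‖ := by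
    conv_lhs => rw [hbz, norm_natCast_mul]
    push_cast; rfl
  have hPk : (0 : ℝ) < (P : ℝ) ^ k := pow_pos hP0 _
  have hzeq : ‖z‖ = ‖b‖ / (P : ℝ) ^ k := by rw [hnorm]; field_simp
  have hzpos : 0 < ‖z‖ := by rw [hzeq]; positivity
  have hsplit : ‖b‖ ^ (1 - α) = ‖b‖ / ‖b‖ ^ α := by
    rw [Real.rpow_sub ht0, Real.rpow_one]
  have hbα : 0 < ‖b‖ ^ α := Real.rpow_pos_of_pos ht0 _
  have hzlow : ‖b‖ ^ (1 - α) ≤ ‖z‖ := by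
    rw [hzeq, hsplit]; gcongr
  have hzup : ‖z‖ ≤ P * ‖b‖ ^ (1 - α) := by
    rw [hzeq, hsplit, div_le_iff₀ hPk]
    rw [pow_succ'] at hk'
    calc ‖b‖ = ‖b‖ / ‖b‖ ^ α * ‖b‖ ^ α := by field_simp
      _ ≤ ‖b‖ / ‖b‖ ^ α * (P * (P : ℝ) ^ k) := by gcongr
      _ = _ := by ring
  have herr : ∀ i (σ : S), ‖(z 0 : ℤ_[((σ : Nat.Primes) : ℕ)]) * y σ i - z i.succ‖ ≤
      C * ‖b‖ ^ (-e i σ) := by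
    intro i σ
    have hb' := hb i σ
    have hfac : (b 0 : ℤ_[((σ : Nat.Primes) : ℕ)]) * y σ i - b i.succ =
        ((P : ℕ) : ℤ_[((σ : Nat.Primes) : ℕ)]) ^ k *
          ((z 0 : ℤ_[((σ : Nat.Primes) : ℕ)]) * y σ i - z i.succ) := by
      rw [hz 0, hz i.succ]; push_cast; ring
    rw [hfac, norm_mul] at hb'
    by_cases hσ : σ = ν
    · subst hσ
      simp only [e, if_pos]
      rw [norm_pow, PadicInt.norm_p, inv_pow, inv_mul_le_iff₀ hPk] at hb'
      rw [show -(τ i σ - α) = α + -τ i σ by ring, Real.rpow_add ht0]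
      have hC : 0 ≤ C * ‖b‖ ^ (-τ i σ) := by
        refine le_trans ?_ (hb i σ); exact norm_nonneg _
      calc _ ≤ _ := hb'
        _ ≤ ‖b‖ ^ α * (C * ‖b‖ ^ (-τ i σ)) := by gcongr
        _ = _ := by ring
    · rw [norm_primes_natCast_eq_one hσ, one_mul] at hb'
      simpa only [e, if_neg hσ] using hb'
  -- Approximability is defined with `b₀y - b_i`, the exponent with `b₀y + b_i`; the sign change
  -- reconciles the two.
  have hmem : negTail z ∈ F := by
    intro i σ
    have hm := hmodpos i σ
    rw [norm_negTail]
    have hval : ((negTail z 0 : ℤ) : ℤ_[((σ : Nat.Primes) : ℕ)]) * y σ i + (negTail z i.succ : ℤ) =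
        (z 0 : ℤ_[((σ : Nat.Primes) : ℕ)]) * y σ i - z i.succ := by
      simp [negTail, Fin.succ_ne_zero, sub_eq_add_neg]
    rw [hval]
    have hle : ‖(z 0 : ℤ_[((σ : Nat.Primes) : ℕ)]) * y σ i - z i.succ‖ ≤
        ‖z‖ ^ (-(ω' * modWeights τ ν α i σ)) := by
      refine (herr i σ).trans ((ht i σ).trans ?_)
      have hneg : -(ω' * modWeights τ ν α i σ) ≤ 0 := by
        have := mul_pos hω'pos hm; linarith
      refine le_trans (le_of_eq ?_) (Real.rpow_le_rpow_of_nonpos hzpos hzup hneg)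
      rw [Real.mul_rpow hP0.le (by positivity), ← Real.rpow_mul ht0.le]
      congr 2; ring
    calc _ ≤ (‖z‖ ^ (-(ω' * modWeights τ ν α i σ))) ^ (1 / modWeights τ ν α i σ) :=
          Real.rpow_le_rpow (norm_nonneg _) hle (by positivity)
      _ = _ := by
          rw [← Real.rpow_mul hzpos.le, one_div, one_div, ← Real.rpow_neg hzpos.le]
          congr 1; field_simp
  have := hR ⟨_, hmem, rfl⟩
  simp only [norm_negTail] at this
  linarith

end Exponent

/-! ### Differentiability -/

section Derivative

variable {p : ℕ} [hp : Fact p.Prime] {d : ℕ}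

/-- Move from `x` to `x'` one coordinate at a time. Each increment is a first difference quotient
times `x'_i - x_i`, and its continuous extension `g i` is close to `g i (x, 0)` near `x`. -/
theorem exists_quot1_limit {f : (Fin d → ℤ_[p]) → ℤ_[p]} {U : Set (Fin d → ℤ_[p])}
    (hU : IsOpen U) (hf : IsC2On f U) {x : Fin d → ℤ_[p]} (hx : x ∈ U) :
    ∃ D : Fin d → ℚ_[p], ∀ ε > 0, ∃ ρ > 0, ∀ x', ‖x' - x‖ < ρ →
      ‖((f x' : ℚ_[p]) - f x) - ∑ i, D i * ((x' i : ℚ_[p]) - x i)‖ ≤ ε * ‖x' - x‖ := by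
  choose g hg hgq using hf.2.1
  refine ⟨fun i => g i (x, 0), fun ε hε => ?_⟩
  obtain ⟨ρ₀, hρ₀, hball⟩ := Metric.isOpen_iff.1 hU x hx
  have hcont : ∀ i, ∃ δ > 0, ∀ (z : Fin d → ℤ_[p]) (h : ℤ_[p]), z ∈ U → z + Pi.single i h ∈ U →
      ‖z - x‖ < δ → ‖h‖ < δ → ‖g i (z, h) - g i (x, 0)‖ < ε := by
    intro i
    obtain ⟨δ, hδ, h⟩ := Metric.continuousOn_iff.1 (hg i) (x, 0) (by simpa using hx) ε hε
    refine ⟨δ, hδ, fun z t hz hzt hz' ht => ?_⟩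
    rw [← dist_eq_norm]
    refine h (z, t) ⟨hz, hzt⟩ ?_
    rw [Prod.dist_eq, dist_eq_norm, dist_eq_norm, sub_zero]
    exact max_lt hz' ht
  choose δ hδ hgδ using hcont
  obtain ⟨ρ₁, hρ₁, hρδ⟩ : ∃ ρ₁ > 0, ∀ i, ρ₁ ≤ δ i := by
    rcases isEmpty_or_nonempty (Fin d) with h | h
    · exact ⟨1, one_pos, fun i => h.elim i⟩
    · exact ⟨Finset.univ.inf' Finset.univ_nonempty δ, by simpa using hδ,
        fun i => Finset.inf'_le _ (Finset.mem_univ i)⟩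
  refine ⟨min ρ₀ ρ₁, lt_min hρ₀ hρ₁, fun x' hx' => ?_⟩
  let z : ℕ → Fin d → ℤ_[p] := fun k i => if (i : ℕ) < k then x' i else x i
  have hzx : ∀ k, ‖z k - x‖ ≤ ‖x' - x‖ := by
    intro k
    refine (pi_norm_le_iff_of_nonneg (norm_nonneg _)).2 fun i => ?_
    simp only [z, Pi.sub_apply]
    split_ifs
    · exact norm_le_pi_norm (x' - x) i
    · simp
  have hzU : ∀ k, z k ∈ U := fun k => hball (by
    rw [Metric.mem_ball, dist_eq_norm]
    exact (hzx k).trans_lt (hx'.trans_le (min_le_left _ _)))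
  have hstep : ∀ i : Fin d, z (i + 1) = z i + Pi.single i (x' i - x i) := by
    intro i
    funext j
    rcases lt_trichotomy j i with h | h | h
    · have h1 : (j : ℕ) < i := h
      simp [z, h1.trans (Nat.lt_succ_self _), h.ne, h.not_ge]
    · subst h; simp [z]
    · have h1 : (i : ℕ) < j := h
      have h2 : ¬ ((j : ℕ) < i + 1) := by omega
      simp [z, h2, h.ne', h.not_gt]
  have hinc : ∀ i : Fin d, (f (z (i + 1)) : ℚ_[p]) - f (z i) =
      g i (z i, x' i - x i) * ((x' i : ℚ_[p]) - x i) := by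
    intro i
    by_cases h0 : x' i - x i = 0
    · have h1 : (x' i : ℚ_[p]) - x i = 0 := by rw [← PadicInt.coe_sub, h0, PadicInt.coe_zero]
      rw [hstep i, h0, h1]; simp
    · have hU' := hzU (i + 1)
      rw [hstep i] at hU'
      rw [hgq i (z i) (x' i - x i) (hzU i) hU' h0, quot1, hstep i, ← PadicInt.coe_sub,
        ← PadicInt.coe_sub]
      have : ((x' i - x i : ℤ_[p]) : ℚ_[p]) ≠ 0 := PadicInt.coe_ne_zero.2 h0
      field_simp
  have htel : (f x' : ℚ_[p]) - f x =
      ∑ i : Fin d, g i (z i, x' i - x i) * ((x' i : ℚ_[p]) - x i) := by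
    have h0 : z 0 = x := by funext i; simp [z]
    have hd : z d = x' := by funext i; simp [z]
    rw [← Finset.sum_congr rfl fun i _ => hinc i,
      ← Finset.sum_range fun k => ((f (z (k + 1)) : ℚ_[p]) - f (z k)),
      Finset.sum_range_sub fun k => (f (z k) : ℚ_[p]), h0, hd]
  rw [htel, ← Finset.sum_sub_distrib]
  refine IsUltrametricDist.norm_sum_le_of_forall_le_of_nonneg (by positivity) fun i _ => ?_
  have hcoord : ‖x' i - x i‖ ≤ ‖x' - x‖ := norm_le_pi_norm (x' - x) i
  rw [← sub_mul, norm_mul, ← PadicInt.coe_sub, PadicInt.padic_norm_e_of_padicInt]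
  have hU' := hzU (i + 1)
  rw [hstep i] at hU'
  have hlt : ‖x' - x‖ < δ i := hx'.trans_le ((min_le_right _ _).trans (hρδ i))
  have := (hgδ i (z i) (x' i - x i) (hzU i) hU' ((hzx i).trans_lt hlt)
    (hcoord.trans_lt hlt)).le
  gcongr

/-- Partial derivatives may fail to be integral; multiplying by `q = p ^ s` keeps the tangent forms
over `ℤ_[p]`, where the pigeonhole argument applies. -/
theorem exists_integral_derivative {f : (Fin d → ℤ_[p]) → ℤ_[p]} {U : Set (Fin d → ℤ_[p])}
    (hU : IsOpen U) (hf : IsC2On f U) {x : Fin d → ℤ_[p]} (hx : x ∈ U) :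
    ∃ q : ℤ_[p], q ≠ 0 ∧ ∃ D : Fin d → ℤ_[p], ∀ ε > 0, ∃ ρ > 0, ∀ x', ‖x' - x‖ < ρ →
      ‖q * (f x' - f x) - ∑ i, D i * (x' i - x i)‖ ≤ ε * ‖x' - x‖ := by
  obtain ⟨D, hD⟩ := exists_quot1_limit hU hf hx
  obtain ⟨s, hs⟩ := pow_unbounded_of_one_lt ‖D‖ (one_lt_cast_prime (p := p))
  have hint : ∀ i, ‖(p : ℚ_[p]) ^ s * D i‖ ≤ 1 := by
    intro i
    rw [norm_mul, norm_pow, Padic.norm_p, inv_pow, inv_mul_le_iff₀ (pow_pos cast_prime_pos _),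
      mul_one]
    exact (norm_le_pi_norm D i).trans hs.le
  let D' : Fin d → ℤ_[p] := fun i => ⟨_, hint i⟩
  have hD' : ∀ i, (D' i : ℚ_[p]) = (p : ℚ_[p]) ^ s * D i := fun i => rfl
  refine ⟨(p : ℤ_[p]) ^ s, pow_ne_zero _ PadicInt.prime_p.ne_zero, D', fun ε hε => ?_⟩
  obtain ⟨ρ, hρ, h⟩ := hD ε hε
  refine ⟨ρ, hρ, fun x' hx' => le_trans ?_ (h x' hx')⟩
  rw [PadicInt.norm_def]
  have : ((((p : ℤ_[p]) ^ s * (f x' - f x) -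
      ∑ i, D' i * (x' i - x i) : ℤ_[p])) : ℚ_[p]) =
      (p : ℚ_[p]) ^ s * (((f x' : ℚ_[p]) - f x) - ∑ i, D i * ((x' i : ℚ_[p]) - x i)) := by
    rw [PadicInt.coe_sub, PadicInt.coe_mul, PadicInt.coe_sub, PadicInt.coe_sum,
      mul_sub ((p : ℚ_[p]) ^ s) ((f x' : ℚ_[p]) - f x) _, Finset.mul_sum]
    congr 1
    refine Finset.sum_congr rfl fun i _ => by
      rw [PadicInt.coe_mul, PadicInt.coe_sub, hD' i]; ring
  rw [this, norm_mul]
  refine mul_le_of_le_one_left (norm_nonneg _) ?_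
  rw [norm_pow]
  exact pow_le_one₀ (norm_nonneg _) (by simpa using PadicInt.norm_le_one (p : ℤ_[p]))

end Derivative

/-! ### Solutions with large denominators -/

section Solutions

variable {S : Finset Nat.Primes} {d m : ℕ}

/-- The linear form `b ↦ b₀ y_i - b_i`. -/
def errForm {p : ℕ} [Fact p.Prime] {n : ℕ} (y : Fin n → ℤ_[p]) (i : Fin n) : Fin (n + 1) → ℤ_[p] :=
  Pi.single 0 (y i) - Pi.single i.succ 1

theorem formVal_errForm {p : ℕ} [Fact p.Prime] {n : ℕ} (y : Fin n → ℤ_[p]) (i : Fin n)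
    (b : Fin (n + 1) → ℤ) : formVal (errForm y i) b = (b 0 : ℤ_[p]) * y i - b i.succ := by
  change (errForm y i) ⬝ᵥ (fun j => (b j : ℤ_[p])) = _
  rw [errForm, sub_dotProduct, single_dotProduct, single_dotProduct, one_mul, mul_comm]

/-- The linearised system: the forms `b₀ y_i - b_i` for the first `d` coordinates, and
`q_j (b₀ y_{d+j} - b_{d+j}) - ∑ i, D_{j,i} (b₀ y_i - b_i)` for the remaining ones. -/
def tangentForm {p : ℕ} [Fact p.Prime] (y : Fin (d + m) → ℤ_[p]) (q : Fin m → ℤ_[p])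
    (D : Fin m → Fin d → ℤ_[p]) : Fin (d + m) → Fin (d + m + 1) → ℤ_[p] :=
  Fin.addCases (fun i => errForm y (Fin.castAdd m i))
    fun j => q j • errForm y (Fin.natAdd d j) - ∑ i, D j i • errForm y (Fin.castAdd m i)

theorem formVal_tangentForm_castAdd {p : ℕ} [Fact p.Prime] (y : Fin (d + m) → ℤ_[p])
    (q : Fin m → ℤ_[p]) (D : Fin m → Fin d → ℤ_[p]) (i : Fin d) (b : Fin (d + m + 1) → ℤ) :
    formVal (tangentForm y q D (Fin.castAdd m i)) b =
      (b 0 : ℤ_[p]) * y (Fin.castAdd m i) - b (Fin.castAdd m i).succ := by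
  rw [tangentForm, Fin.addCases_left, formVal_errForm]

theorem formVal_tangentForm_natAdd {p : ℕ} [Fact p.Prime] (y : Fin (d + m) → ℤ_[p])
    (q : Fin m → ℤ_[p]) (D : Fin m → Fin d → ℤ_[p]) (j : Fin m) (b : Fin (d + m + 1) → ℤ) :
    formVal (tangentForm y q D (Fin.natAdd d j)) b =
      q j * ((b 0 : ℤ_[p]) * y (Fin.natAdd d j) - b (Fin.natAdd d j).succ) -
        ∑ i, D j i * ((b 0 : ℤ_[p]) * y (Fin.castAdd m i) - b (Fin.castAdd m i).succ) := by
  simp only [← formVal_errForm]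
  rw [tangentForm, Fin.addCases_right]
  change (_ - _) ⬝ᵥ (fun j => (b j : ℤ_[p])) = _
  rw [sub_dotProduct, smul_dotProduct, sum_dotProduct]
  simp only [smul_dotProduct]
  rfl

/-- The first `d` constants can be chosen so large that the product of all of them exceeds any
given bound. -/
theorem exists_const_prod_ge (hS : S.Nonempty) (hd : 0 < d) {ε : ℝ} (hε : 0 < ε) (B : ℝ) :
    ∃ C : ℝ, 0 < C ∧ B ≤ ∏ k : Fin (d + m) × S,
      (Fin.addCases (fun _ => C) (fun _ => ε) k.1 : ℝ) := by
  have hE : 0 < (ε ^ S.card) ^ m := by positivity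
  refine ⟨max 1 (B / (ε ^ S.card) ^ m), by positivity, ?_⟩
  set C := max 1 (B / (ε ^ S.card) ^ m) with hC
  have h1 : (1 : ℝ) ≤ C := le_max_left _ _
  have h2 : B ≤ C * (ε ^ S.card) ^ m := by
    rw [← div_le_iff₀ hE]; exact le_max_right _ _
  rw [Fintype.prod_prod_type, Fin.prod_univ_add]
  simp only [Fin.addCases_left, Fin.addCases_right, Finset.prod_const, Finset.card_univ,
    Fintype.card_coe, Fintype.card_fin]
  refine h2.trans ?_
  gcongr
  rw [← pow_mul]
  exact le_self_pow₀ h1 (mul_pos hS.card_pos hd).ne'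

/-- The dichotomy above for the linearised system. In the unbounded case `hden` or primitivity makes
some entry large at each place, and this is transferred to `b₀`. The constant `C` is independent of
`T`, as the density argument needs. -/
theorem exists_large_solutions (hd : 0 < d) {τ : Fin (d + m) → S → ℝ} (hτpos : ∀ i ν, 0 < τ i ν)
    (hτsum : ∑ i, ∑ ν, τ i ν = ((d + m : ℕ) : ℝ) + 1)
    (hτdom : ∀ ν (i : Fin d) (j : Fin m), τ (Fin.natAdd d j) ν ≤ τ (Fin.castAdd m i) ν)
    (y : ZS S (d + m)) (q : ∀ ν : S, Fin m → ℤ_[((ν : Nat.Primes) : ℕ)]) (hq : ∀ ν j, q ν j ≠ 0)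
    (D : ∀ ν : S, Fin m → Fin d → ℤ_[((ν : Nat.Primes) : ℕ)]) {α : S → ℝ}
    (hα0 : ∀ ν, 0 < α ν) (hα : ∀ i ν, α ν < τ i ν)
    (hden : ∀ ν : S, (∀ i, 1 < τ i ν) ∨ ∀ C : ℝ, ∀ᶠ t : ℝ in atTop, ∀ b : Fin (d + m + 1) → ℤ,
      ‖b‖ = t → (∀ i (σ : S), ‖(b 0 : ℤ_[((σ : Nat.Primes) : ℕ)]) * y σ i - b i.succ‖ ≤
        C * ‖b‖ ^ (-τ i σ)) → ∃ j, ‖b‖ ^ (-α ν) < ‖(b j : ℤ_[((ν : Nat.Primes) : ℕ)])‖)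
    {ε : ℝ} (hε : 0 < ε) :
    (∃ b : Fin (d + m + 1) → ℤ, b ≠ 0 ∧
      ∀ i (ν : S), (b 0 : ℤ_[((ν : Nat.Primes) : ℕ)]) * y ν i = b i.succ) ∨
    ∃ C > 0, ∀ T : ℝ, ∃ b : Fin (d + m + 1) → ℤ, b ≠ 0 ∧ T ≤ ‖b‖ ∧
      (∀ (ν : S) i, ‖(b 0 : ℤ_[((ν : Nat.Primes) : ℕ)]) * y ν (Fin.castAdd m i) -
        b (Fin.castAdd m i).succ‖ ≤ C * ‖b‖ ^ (-τ (Fin.castAdd m i) ν)) ∧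
      (∀ (ν : S) j, ‖q ν j * ((b 0 : ℤ_[((ν : Nat.Primes) : ℕ)]) * y ν (Fin.natAdd d j) -
        b (Fin.natAdd d j).succ) - ∑ i, D ν j i * ((b 0 : ℤ_[((ν : Nat.Primes) : ℕ)]) *
          y ν (Fin.castAdd m i) - b (Fin.castAdd m i).succ)‖ ≤
          ε * ‖b‖ ^ (-τ (Fin.natAdd d j) ν)) ∧
      ∀ ν : S, ‖b‖ ^ (-α ν) ≤ ‖(b 0 : ℤ_[((ν : Nat.Primes) : ℕ)])‖ := by
  classical
  have hS : S.Nonempty := by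
    by_contra h
    rw [Finset.not_nonempty_iff_eq_empty] at h
    subst h
    have : (((d + m : ℕ) : ℝ) + 1) = 0 := by rw [← hτsum]; simp
    linarith [Nat.cast_nonneg (α := ℝ) (d + m)]
  let P : Fin (d + m) × S → ℕ := fun k => ((k.2 : Nat.Primes) : ℕ)
  obtain ⟨C, hC, hprod⟩ := exists_const_prod_ge (d := d) (m := m) hS hd hε
    (∏ k : Fin (d + m) × S, (P k : ℝ))
  let c : Fin (d + m) × S → ℝ := fun k => Fin.addCases (fun _ => C) (fun _ => ε) k.1
  have hcl : ∀ (i : Fin d) (ν : S), c (Fin.castAdd m i, ν) = C := fun i ν => by simp [c]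
  have hcr : ∀ (j : Fin m) (ν : S), c (Fin.natAdd d j, ν) = ε := fun j ν => by simp [c]
  have hcpos : ∀ k, 0 < c k := by
    rintro ⟨k, ν⟩
    refine Fin.addCases (fun i => ?_) (fun j => ?_) k
    · rw [hcl]; exact hC
    · rw [hcr]; exact hε
  -- Membership depends only on the place, so primes inside and outside `A` are distinct.
  let A : Set (Fin (d + m) × S) := {k | ∀ i, 1 < τ i k.2}
  rcases exists_formVal_eq_zero_or_unbounded P (fun k => tangentForm (y k.2) (q k.2) (D k.2) k.1)
    (fun k => τ k.1 k.2) c (fun k => hτpos _ _) hcpos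
    (by rw [Fintype.sum_prod_type]; exact_mod_cast hτsum) (Nat.succ_ne_zero _) hprod A
    (fun k hk l hl h => hl (by
      have : k.2 = l.2 := Subtype.ext (Subtype.ext h)
      intro i; rw [← this]; exact hk i)) (fun k hk => hk k.1) with h | h
  · left
    obtain ⟨b, hb, hz⟩ := h
    have h1 : ∀ (i : Fin d) (ν : S), (b 0 : ℤ_[((ν : Nat.Primes) : ℕ)]) * y ν (Fin.castAdd m i) -
        b (Fin.castAdd m i).succ = 0 := fun i ν => by
      have := hz (Fin.castAdd m i, ν)
      rwa [formVal_tangentForm_castAdd] at this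
    refine ⟨b, hb, fun k ν => sub_eq_zero.1 ?_⟩
    refine Fin.addCases (fun i => h1 i ν) (fun j => ?_) k
    have := hz (Fin.natAdd d j, ν)
    rw [formVal_tangentForm_natAdd] at this
    simp only [h1, mul_zero, Finset.sum_const_zero, sub_zero] at this
    exact (mul_eq_zero.1 this).resolve_left (hq ν j)
  right
  refine ⟨C, hC, fun T => ?_⟩
  -- A bound for all `|q|⁻¹`, needed to recover the error in `y_{d+j}` from the tangent form, which
  -- only controls `q` times it.
  let K : ℝ := 1 + ∑ k : S × Fin m, ‖q k.1 k.2‖⁻¹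
  have hKsum : 0 ≤ ∑ k : S × Fin m, ‖q k.1 k.2‖⁻¹ := Finset.sum_nonneg fun _ _ => by positivity
  have hK1 : 1 ≤ K := by simpa [K] using hKsum
  have hKq : ∀ ν j, ‖q ν j‖⁻¹ ≤ K := fun ν j => by
    have := Finset.single_le_sum (f := fun k : S × Fin m => ‖q k.1 k.2‖⁻¹)
      (fun _ _ => by positivity) (Finset.mem_univ (ν, j))
    simp only [K]; linarith
  set C' := max ε C * K with hC'
  have hlarge : ∀ᶠ t : ℝ in atTop, ∀ ν : S, ∀ b : Fin (d + m + 1) → ℤ,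
      ‖b‖ = t → (∀ i (σ : S), ‖(b 0 : ℤ_[((σ : Nat.Primes) : ℕ)]) * y σ i - b i.succ‖ ≤
        C' * ‖b‖ ^ (-τ i σ)) →
      ((∀ i, 1 < τ i ν) → ∃ j, ‖(b j : ℤ_[((ν : Nat.Primes) : ℕ)])‖ = 1) →
      ∃ j, ‖b‖ ^ (-α ν) < ‖(b j : ℤ_[((ν : Nat.Primes) : ℕ)])‖ := by
    refine eventually_all.2 fun ν => ?_
    rcases hden ν with h1 | h1
    · filter_upwards [eventually_gt_atTop 1] with t ht b hbt _ hb
      obtain ⟨j, hj⟩ := hb h1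
      refine ⟨j, ?_⟩
      rw [hj, hbt]
      exact Real.rpow_lt_one_of_one_lt_of_neg ht (by linarith [hα0 ν])
    · filter_upwards [h1 C'] with t ht b hbt hb _
      exact ht b hbt hb
  have hlarge' : ∀ᶠ t : ℝ in atTop, ∀ i (ν : S), C' * t ^ (-τ i ν) ≤ 1 * t ^ (-α ν) :=
    eventually_all.2 fun i => eventually_all.2 fun ν =>
      eventually_const_mul_rpow_le one_pos (hα i ν)
  obtain ⟨T', hT'⟩ := eventually_atTop.1 (hlarge.and hlarge')
  obtain ⟨b, hb, hbT, hbc, hbA⟩ := h (max T T')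
  have hb1 := one_le_norm_of_ne_zero hb
  have hb0 : 0 < ‖b‖ := by linarith
  have hl : ∀ (ν : S) i, ‖(b 0 : ℤ_[((ν : Nat.Primes) : ℕ)]) * y ν (Fin.castAdd m i) -
        b (Fin.castAdd m i).succ‖ ≤ C * ‖b‖ ^ (-τ (Fin.castAdd m i) ν) := fun ν i => by
    have := hbc (Fin.castAdd m i, ν)
    rwa [formVal_tangentForm_castAdd, hcl] at this
  have hr : ∀ (ν : S) j, ‖q ν j * ((b 0 : ℤ_[((ν : Nat.Primes) : ℕ)]) * y ν (Fin.natAdd d j) -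
        b (Fin.natAdd d j).succ) - ∑ i, D ν j i * ((b 0 : ℤ_[((ν : Nat.Primes) : ℕ)]) *
          y ν (Fin.castAdd m i) - b (Fin.castAdd m i).succ)‖ ≤
          ε * ‖b‖ ^ (-τ (Fin.natAdd d j) ν) := fun ν j => by
    have := hbc (Fin.natAdd d j, ν)
    rwa [formVal_tangentForm_natAdd, hcr] at this
  have hall : ∀ k (ν : S), ‖(b 0 : ℤ_[((ν : Nat.Primes) : ℕ)]) * y ν k - b k.succ‖ ≤
      C' * ‖b‖ ^ (-τ k ν) := by
    intro k ν
    refine Fin.addCases (fun i => ?_) (fun j => ?_) k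
    · refine (hl ν i).trans ?_
      gcongr
      exact (le_max_right ε C).trans (le_mul_of_one_le_right (hε.le.trans (le_max_left _ _)) hK1)
    · have hV : 0 < ‖b‖ ^ (-τ (Fin.natAdd d j) ν) := Real.rpow_pos_of_pos hb0 _
      have hsum : ‖∑ i, D ν j i * ((b 0 : ℤ_[((ν : Nat.Primes) : ℕ)]) *
          y ν (Fin.castAdd m i) - b (Fin.castAdd m i).succ)‖ ≤
          max ε C * ‖b‖ ^ (-τ (Fin.natAdd d j) ν) := by
        refine IsUltrametricDist.norm_sum_le_of_forall_le_of_nonneg (by positivity) fun i _ => ?_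
        rw [norm_mul]
        refine (mul_le_of_le_one_left (norm_nonneg _) (PadicInt.norm_le_one _)).trans
          ((hl ν i).trans ?_)
        gcongr
        · exact le_max_right _ _
        · exact hτdom ν i j
      have hqe : ‖q ν j‖ * ‖(b 0 : ℤ_[((ν : Nat.Primes) : ℕ)]) * y ν (Fin.natAdd d j) -
          b (Fin.natAdd d j).succ‖ ≤ max ε C * ‖b‖ ^ (-τ (Fin.natAdd d j) ν) := by
        rw [← norm_mul, ← sub_add_cancel (q ν j * _) (∑ i, D ν j i *
          ((b 0 : ℤ_[((ν : Nat.Primes) : ℕ)]) * y ν (Fin.castAdd m i) - b (Fin.castAdd m i).succ))]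
        refine (PadicInt.nonarchimedean _ _).trans (max_le ((hr ν j).trans ?_) hsum)
        gcongr
        exact le_max_left _ _
      have hqpos : 0 < ‖q ν j‖ := norm_pos_iff.2 (hq ν j)
      rw [← le_div_iff₀' hqpos] at hqe
      refine hqe.trans ?_
      rw [div_eq_mul_inv, mul_right_comm, hC']
      gcongr
      exact hKq ν j
  refine ⟨b, hb, (le_max_left _ _).trans hbT, hl, hr, fun ν => ?_⟩
  obtain ⟨hT1, hT2⟩ := hT' ‖b‖ ((le_max_right _ _).trans hbT)
  obtain ⟨j, hj⟩ := hT1 ν b rfl hall fun h1 => hbA (Fin.castAdd m ⟨0, hd⟩, ν) h1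
  revert hj
  -- If the large entry is some `b_i` with `i ≥ 1` and `b₀` is small, then `b_i = b₀y_i - (b₀y_i -
  -- b_i)` is small too, a contradiction.
  refine Fin.cases (fun hj => hj.le) (fun i hj => ?_) j
  have herr := (hall i ν).trans (hT2 i ν)
  rw [one_mul] at herr
  by_contra! hcon
  have hle : ‖(b i.succ : ℤ_[((ν : Nat.Primes) : ℕ)])‖ ≤ ‖b‖ ^ (-α ν) := by
    rw [show (b i.succ : ℤ_[((ν : Nat.Primes) : ℕ)]) = (b 0 : ℤ_[((ν : Nat.Primes) : ℕ)]) * y ν i +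
      -((b 0 : ℤ_[((ν : Nat.Primes) : ℕ)]) * y ν i - b i.succ) by ring]
    refine (PadicInt.nonarchimedean _ _).trans (max_le ?_ (by rwa [norm_neg]))
    rw [norm_mul]
    exact (mul_le_of_le_one_right (norm_nonneg _) (PadicInt.norm_le_one _)).trans hcon.le
  exact absurd hle (not_le.2 hj)

end Solutions

/-! ### Local geometry around a solution -/

section Local

variable {p : ℕ} [hp : Fact p.Prime] {d : ℕ}

theorem exists_eq_mul_of_norm_le {a b : ℤ_[p]} (hb : b ≠ 0) (h : ‖a‖ ≤ ‖b‖) :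
    ∃ u, a = b * u := by
  have hb' : (b : ℚ_[p]) ≠ 0 := PadicInt.coe_ne_zero.2 hb
  have hn : ‖(a : ℚ_[p]) / b‖ ≤ 1 := by
    rw [norm_div]
    exact div_le_one_of_le₀ h (norm_nonneg _)
  refine ⟨⟨_, hn⟩, PadicInt.ext ?_⟩
  change (a : ℚ_[p]) = b * ((a : ℚ_[p]) / b)
  field_simp

/-- The centre is `b₁/b₀`, integral because the error is divisible by `b₀`. The level `l` comes from
rounding the radius `Cv/|b₀|` up to a power of `p`, whence the factor `p`. -/
theorem exists_padicBall_of_approx {C η v : ℝ} (hC : 0 < C) (hv : 0 < v) {s k : ℕ}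
    (hs : C * p * (p : ℝ) ^ (-s : ℤ) ≤ η) {x b₀ b₁ : ℤ_[p]} (hb : b₀ ≠ 0)
    (hx : ‖b₀ * x - b₁‖ ≤ C * v) (hk : C * v ≤ (p : ℝ) ^ (-k : ℤ) * ‖b₀‖) :
    ∃ (w : ℤ_[p]) (l : ℕ), k ≤ l ∧ x ∈ padicBall w l ∧ ∀ x' ∈ padicBall w (l + s),
      ‖b₀ * x' - b₁‖ ≤ η * v ∧ ‖x' - x‖ ≤ (p : ℝ) ^ (-k : ℤ) ∧ ‖b₀‖ * ‖x' - x‖ ≤ C * p * v := by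
  have hp0 := cast_prime_pos (p := p)
  have hb' : 0 < ‖b₀‖ := norm_pos_iff.2 hb
  have hpk : (p : ℝ) ^ (-k : ℤ) ≤ 1 :=
    zpow_le_one_of_nonpos₀ one_lt_cast_prime.le (by simp)
  have hr0 : 0 < C * v / ‖b₀‖ := by positivity
  have hrk : C * v / ‖b₀‖ ≤ (p : ℝ) ^ (-k : ℤ) := (div_le_iff₀ hb').2 hk
  obtain ⟨l, hl, hl'⟩ := exists_padicBall_radius (p := p) hr0 (hrk.trans hpk)
  have hkl : k ≤ l := by
    have := (zpow_lt_zpow_iff_right₀ (one_lt_cast_prime (p := p))).1 (hl.trans_le hrk)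
    omega
  obtain ⟨u, hu⟩ := exists_eq_mul_of_norm_le hb
    (hx.trans (hk.trans (mul_le_of_le_one_left hb'.le hpk)))
  have hxw : x ∈ padicBall (x - u) l := by
    rw [mem_padicBall, sub_sub_cancel]
    refine le_trans ?_ hl'
    rw [le_div_iff₀ hb', mul_comm, ← norm_mul, ← hu]
    exact hx
  have hlr : (p : ℝ) ^ (-l : ℤ) * ‖b₀‖ ≤ C * p * v := by
    rw [zpow_sub_one₀ hp0.ne', lt_div_iff₀ hb'] at hl
    calc (p : ℝ) ^ (-l : ℤ) * ‖b₀‖ = p * ((p : ℝ) ^ (-l : ℤ) * (p : ℝ)⁻¹ * ‖b₀‖) := by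
          field_simp
      _ ≤ p * (C * v) := by gcongr
      _ = _ := by ring
  refine ⟨x - u, l, hkl, hxw, fun x' hx' => ?_⟩
  have hxx : ‖x' - x‖ ≤ (p : ℝ) ^ (-l : ℤ) := by
    have h := padicBall_anti _ (Nat.le_add_right l s) hx'
    rwa [padicBall_eq_of_mem hxw, mem_padicBall] at h
  refine ⟨?_, hxx.trans (zpow_le_zpow_right₀ one_lt_cast_prime.le (by omega)), ?_⟩
  · rw [mem_padicBall] at hx'
    rw [show b₀ * x' - b₁ = b₀ * (x' - (x - u)) by linear_combination hu, norm_mul]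
    calc ‖b₀‖ * ‖x' - (x - u)‖ ≤ ‖b₀‖ * (p : ℝ) ^ (-(l + s : ℕ) : ℤ) := by gcongr
      _ = ((p : ℝ) ^ (-l : ℤ) * ‖b₀‖) * (p : ℝ) ^ (-s : ℤ) := by
          rw [Nat.cast_add, neg_add, zpow_add₀ hp0.ne']; ring
      _ ≤ (C * p * v) * (p : ℝ) ^ (-s : ℤ) := by gcongr
      _ = (C * p * (p : ℝ) ^ (-s : ℤ)) * v := by ring
      _ ≤ η * v := by gcongr
  · rw [mul_comm]
    exact (mul_le_mul_of_nonneg_right hxx hb'.le).trans hlr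

/-- The quantity `q(b₀y' - c)` is the sum of `b₀` times the Taylor remainder, the combination of the
errors of `x'`, and the tangent form at `x`; each is at most `ηV`. -/
theorem norm_tangent_le {C η V ε : ℝ} (hη : 0 ≤ η) (hV : 0 ≤ V) (hε : 0 ≤ ε)
    (hεη : ε * C ≤ η) {q b₀ c y y' : ℤ_[p]} (hb : b₀ ≠ 0) {D x x' b : Fin d → ℤ_[p]}
    (hder : ‖q * (y' - y) - ∑ i, D i * (x' i - x i)‖ ≤ ε * ‖x' - x‖)
    (hC : 0 ≤ C * V) (hx : ∀ i, ‖b₀‖ * ‖x' i - x i‖ ≤ C * V)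
    (hx' : ∀ i, ‖b₀ * x' i - b i‖ ≤ η * V)
    (htan : ‖q * (b₀ * y - c) - ∑ i, D i * (b₀ * x i - b i)‖ ≤ η * V) :
    ‖q‖ * ‖b₀ * y' - c‖ ≤ η * V := by
  have hb' : 0 < ‖b₀‖ := norm_pos_iff.2 hb
  have hxx : ‖b₀‖ * ‖x' - x‖ ≤ C * V := by
    rw [← le_div_iff₀' hb']
    refine (pi_norm_le_iff_of_nonneg (by positivity)).2 fun i => ?_
    rw [le_div_iff₀' hb']
    exact hx i
  have hid : q * (b₀ * y' - c) = (b₀ * (q * (y' - y) - ∑ i, D i * (x' i - x i)) +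
      ∑ i, D i * (b₀ * x' i - b i)) + (q * (b₀ * y - c) - ∑ i, D i * (b₀ * x i - b i)) := by
    have : ∑ i, D i * (b₀ * x' i - b i) =
        b₀ * ∑ i, D i * (x' i - x i) + ∑ i, D i * (b₀ * x i - b i) := by
      rw [Finset.mul_sum, ← Finset.sum_add_distrib]
      exact Finset.sum_congr rfl fun i _ => by ring
    rw [this]; ring
  rw [← norm_mul, hid]
  refine (PadicInt.nonarchimedean _ _).trans (max_le ?_ htan)
  refine (PadicInt.nonarchimedean _ _).trans (max_le ?_ ?_)
  · rw [norm_mul]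
    calc ‖b₀‖ * _ ≤ ‖b₀‖ * (ε * ‖x' - x‖) := by gcongr
      _ = ε * (‖b₀‖ * ‖x' - x‖) := by ring
      _ ≤ ε * (C * V) := by gcongr
      _ = (ε * C) * V := by ring
      _ ≤ η * V := by gcongr
  · refine IsUltrametricDist.norm_sum_le_of_forall_le_of_nonneg (by positivity) fun i _ => ?_
    rw [norm_mul]
    exact (mul_le_of_le_one_left (norm_nonneg _) (PadicInt.norm_le_one _)).trans (hx' i)

end Local

/-! ### Boxes in `ℤ_S^d` -/

section Boxes

variable {S : Finset Nat.Primes} {d : ℕ}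

instance isFiniteMeasure_haarS : IsFiniteMeasure (haarS S d) := by
  unfold haarS; infer_instance

/-- A product of balls. -/
def boxS (w : ZS S d) (l : S → Fin d → ℕ) : Set (ZS S d) :=
  Set.univ.pi fun ν => Set.univ.pi fun i => padicBall (w ν i) (l ν i)

theorem mem_boxS {w x : ZS S d} {l : S → Fin d → ℕ} :
    x ∈ boxS w l ↔ ∀ ν i, x ν i ∈ padicBall (w ν i) (l ν i) := by
  simp [boxS]

theorem measurableSet_boxS (w : ZS S d) (l : S → Fin d → ℕ) : MeasurableSet (boxS w l) :=
  MeasurableSet.univ_pi fun _ => MeasurableSet.univ_pi fun _ => measurableSet_padicBall _ _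

theorem haarS_boxS (w : ZS S d) (l : S → Fin d → ℕ) :
    haarS S d (boxS w l) = ∏ ν : S, ∏ i : Fin d,
      (Measure.addHaarMeasure ⊤ : Measure ℤ_[((ν : Nat.Primes) : ℕ)])
        (padicBall (w ν i) (l ν i)) := by
  rw [haarS, boxS, Measure.pi_pi]
  exact Finset.prod_congr rfl fun ν _ => Measure.pi_pi _ _

theorem haarS_boxS_pos (w : ZS S d) (l : S → Fin d → ℕ) : 0 < haarS S d (boxS w l) := by
  rw [haarS_boxS]
  exact pos_iff_ne_zero.2 (Finset.prod_ne_zero_iff.2 fun ν _ => Finset.prod_ne_zero_iff.2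
    fun i _ => (haar_padicBall_pos _ _).ne')

/-- The constant depends on `s` but not on the side lengths, so one density threshold serves boxes
of every shape. -/
theorem haarS_boxS_le (w : ZS S d) (l : S → Fin d → ℕ) (s : ℕ) :
    haarS S d (boxS w l) ≤
      (∏ ν : S, ∏ _i : Fin d, (((ν : Nat.Primes) : ℕ) : ℝ≥0∞) ^ s) *
        haarS S d (boxS w fun ν i => l ν i + s) := by
  simp only [haarS_boxS, ← Finset.prod_mul_distrib]
  exact Finset.prod_le_prod' fun ν _ => Finset.prod_le_prod' fun i _ =>
    haar_padicBall_le _ _ _ _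

theorem isDensityBasis_haarS : IsDensityBasis (haarS S d)
    (boxBasis fun ν : S => boxBasis fun _ : Fin d => padicBasis ((ν : Nat.Primes) : ℕ)) :=
  isDensityBasis_boxBasis fun _ => isDensityBasis_boxBasis fun _ => isDensityBasis_padicBasis

/-- Almost every point of `E` is a point of strong density of `E`. -/
theorem ae_strong_density {E : Set (ZS S d)} (hE : MeasurableSet E) :
    ∀ᵐ x ∂haarS S d, x ∈ E → ∀ c : ℝ≥0∞, c < 1 → ∃ k : ℕ, ∀ (w : ZS S d) (l : S → Fin d → ℕ),
      (∀ ν i, k ≤ l ν i) → x ∈ boxS w l → c * haarS S d (boxS w l) ≤ haarS S d (E ∩ boxS w l) := by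
  obtain ⟨u, -, hu1, hu⟩ := exists_seq_strictMono_tendsto' (zero_lt_one' ℝ≥0∞)
  filter_upwards [ae_all_iff.2 fun n => isDensityBasis_haarS.density E hE (u n) (hu1 n).2]
    with x hx hxE c hc
  obtain ⟨n, hn⟩ := (hu.eventually (lt_mem_nhds hc)).exists
  obtain ⟨k, hk⟩ := hx n hxE
  refine ⟨k, fun w l hl hxw => (mul_le_mul_left hn.le _).trans (hk _ ?_ hxw)⟩
  exact ⟨_, fun ν => ⟨_, fun i => ⟨l ν i, hl ν i, w ν i, rfl⟩, rfl⟩, rfl⟩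

/-- A set cannot have density close to one in a box if it misses a sizeable subset of the box. -/
theorem not_dense_of_disjoint {X : Type*} [MeasurableSpace X] {μ : Measure X} [IsFiniteMeasure μ]
    {E R R' : Set X} (hR' : MeasurableSet R') (hsub : R' ⊆ R) (hdisj : Disjoint E R')
    (hpos : 0 < μ R) {K c : ℝ≥0∞} (hK : μ R ≤ K * μ R') (hc : 1 < c + K⁻¹) : μ (E ∩ R) < c * μ R := by
  by_contra! h
  have h1 : K⁻¹ * μ R ≤ μ R' := by
    rw [mul_comm, ← div_eq_mul_inv]
    exact ENNReal.div_le_of_le_mul' hK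
  have h2 : μ (E ∩ R) + μ R' ≤ μ R := by
    rw [← measure_union (hdisj.mono_left Set.inter_subset_left) hR']
    exact measure_mono (Set.union_subset Set.inter_subset_right hsub)
  have h3 : (c + K⁻¹) * μ R ≤ 1 * μ R := by
    rw [add_mul, one_mul]
    exact (add_le_add h h1).trans h2
  rw [ENNReal.mul_le_mul_iff_left hpos.ne' (measure_ne_top _ _)] at h3
  exact absurd h3 (not_le.2 hc)

end Boxes

/-! ### Points avoiding good approximations -/

section Avoid

variable {S : Finset Nat.Primes} {d m : ℕ}

/-- The points of `U` that have no approximation of quality `1 / ℓ` and height at least `T`. -/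
def avoidSet (U : (ν : S) → Set (Fin d → ℤ_[((ν : Nat.Primes) : ℕ)]))
    (f : (ν : S) → (Fin d → ℤ_[((ν : Nat.Primes) : ℕ)]) → Fin m → ℤ_[((ν : Nat.Primes) : ℕ)])
    (τ : Fin (d + m) → S → ℝ) (ℓ : ℕ+) (T : ℕ) : Set (ZS S d) :=
  {x | x ∈ Set.univ.pi U ∧ ∀ b : Fin (d + m + 1) → ℤ, (T : ℝ) ≤ ‖b‖ → ¬ ∀ i (ν : S),
    ‖(b 0 : ℤ_[((ν : Nat.Primes) : ℕ)]) * graphMap f x ν i - b i.succ‖ <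
      1 / (ℓ : ℝ) * ‖b‖ ^ (-τ i ν)}

variable {U : (ν : S) → Set (Fin d → ℤ_[((ν : Nat.Primes) : ℕ)])}
  {f : (ν : S) → (Fin d → ℤ_[((ν : Nat.Primes) : ℕ)]) → Fin m → ℤ_[((ν : Nat.Primes) : ℕ)]}
  {τ : Fin (d + m) → S → ℝ}

theorem bad_subset_iUnion_avoidSet :
    Set.univ.pi U ∩ graphMap f ⁻¹' Bad τ ⊆ ⋃ (ℓ : ℕ+) (T : ℕ), avoidSet U f τ ℓ T := by
  rintro x ⟨hxU, hx⟩
  rw [Set.mem_preimage, Bad, Set.mem_compl_iff, Set.mem_iInter, not_forall] at hx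
  obtain ⟨ℓ, hℓ⟩ := hx
  have hfin := Set.not_infinite.1 hℓ
  obtain ⟨R, hR⟩ := (hfin.image fun b => ‖b‖).bddAbove
  obtain ⟨T, hT⟩ := exists_nat_gt R
  refine Set.mem_iUnion₂.2 ⟨ℓ, T, hxU, fun b hb hcon => ?_⟩
  have : ‖b‖ ≤ R := hR ⟨b, hcon, rfl⟩
  linarith

theorem graphMap_castAdd (x : ZS S d) (ν : S) (i : Fin d) :
    graphMap f x ν (Fin.castAdd m i) = x ν i := Fin.append_left _ _ _

theorem graphMap_natAdd (x : ZS S d) (ν : S) (j : Fin m) :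
    graphMap f x ν (Fin.natAdd d j) = f ν (x ν) j := Fin.append_right _ _ _

theorem continuousOn_graphMap (hf : ∀ ν j, ContinuousOn (fun x => f ν x j) (U ν)) (ν : S)
    (k : Fin (d + m)) : ContinuousOn (fun x => graphMap f x ν k) (Set.univ.pi U) := by
  refine Fin.addCases (fun i => ?_) (fun j => ?_) k
  · simp only [graphMap_castAdd]
    fun_prop
  · simp only [graphMap_natAdd]
    exact (hf ν j).comp (continuous_apply ν).continuousOn fun x hx => hx ν (Set.mem_univ ν)

theorem measurableSet_avoidSet (hU : ∀ ν, IsOpen (U ν))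
    (hf : ∀ ν j, ContinuousOn (fun x => f ν x j) (U ν)) (ℓ : ℕ+) (T : ℕ) :
    MeasurableSet (avoidSet U f τ ℓ T) := by
  have hUo : IsOpen (Set.univ.pi U) := isOpen_set_pi Set.finite_univ fun ν _ => hU ν
  have hO : ∀ b : Fin (d + m + 1) → ℤ, IsOpen (Set.univ.pi U ∩ ⋂ (k : Fin (d + m)) (ν : S),
      (Set.univ.pi U ∩ (fun x => graphMap f x ν k) ⁻¹'
        {z | ‖(b 0 : ℤ_[((ν : Nat.Primes) : ℕ)]) * z - b k.succ‖ <
          1 / (ℓ : ℝ) * ‖b‖ ^ (-τ k ν)})) := fun b =>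
    hUo.inter <| isOpen_iInter_of_finite fun k => isOpen_iInter_of_finite fun ν =>
      (continuousOn_graphMap hf ν k).isOpen_inter_preimage hUo
        (isOpen_lt (by fun_prop) continuous_const)
  have heq : avoidSet U f τ ℓ T = Set.univ.pi U ∩ ⋂ (b : Fin (d + m + 1) → ℤ) (_ : (T : ℝ) ≤ ‖b‖),
      (Set.univ.pi U ∩ ⋂ (k : Fin (d + m)) (ν : S),
      (Set.univ.pi U ∩ (fun x => graphMap f x ν k) ⁻¹'
        {z | ‖(b 0 : ℤ_[((ν : Nat.Primes) : ℕ)]) * z - b k.succ‖ <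
          1 / (ℓ : ℝ) * ‖b‖ ^ (-τ k ν)}))ᶜ := by
    ext x
    constructor
    · rintro ⟨hx, h⟩
      refine ⟨hx, Set.mem_iInter₂.2 fun b hb hcon => h b hb fun i ν => ?_⟩
      exact (Set.mem_iInter.1 (Set.mem_iInter.1 hcon.2 i) ν).2
    · rintro ⟨hx, h⟩
      refine ⟨hx, fun b hb hcon => Set.mem_iInter₂.1 h b hb ⟨hx, ?_⟩⟩
      exact Set.mem_iInter₂.2 fun i ν => ⟨hx, hcon i ν⟩
  rw [heq]
  exact hUo.measurableSet.inter <| MeasurableSet.iInter fun b => MeasurableSet.iInter fun _ =>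
    (hO b).measurableSet.compl

/-- An exact solution has multiples of arbitrary height, all with zero error; the factor `T + 1`
brings the height above `T`. -/
theorem notMem_avoidSet_of_rational {x : ZS S d} {b : Fin (d + m + 1) → ℤ} (hb : b ≠ 0)
    (h : ∀ i (ν : S), (b 0 : ℤ_[((ν : Nat.Primes) : ℕ)]) * graphMap f x ν i = b i.succ)
    (ℓ : ℕ+) (T : ℕ) : x ∉ avoidSet U f τ ℓ T := by
  rintro ⟨-, hx⟩
  have hb1 := one_le_norm_of_ne_zero hb
  have hn : ‖(fun j => ((T + 1 : ℕ) : ℤ) * b j)‖ = (T + 1 : ℕ) * ‖b‖ := norm_natCast_mul _ b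
  have hT : (T : ℝ) + 1 ≤ ‖(fun j => ((T + 1 : ℕ) : ℤ) * b j)‖ := by
    rw [hn]; push_cast
    exact le_mul_of_one_le_right (by positivity) hb1
  have hpos : 0 < ‖(fun j => ((T + 1 : ℕ) : ℤ) * b j)‖ := by
    have := Nat.cast_nonneg (α := ℝ) T
    linarith
  refine hx (fun j => ((T + 1 : ℕ) : ℤ) * b j) (by linarith) fun i ν => ?_
  have h0 : ((((T + 1 : ℕ) : ℤ) * b 0 : ℤ) : ℤ_[((ν : Nat.Primes) : ℕ)]) * graphMap f x ν i -
      (((T + 1 : ℕ) : ℤ) * b i.succ : ℤ) = 0 := by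
    push_cast
    linear_combination ((T : ℤ_[((ν : Nat.Primes) : ℕ)]) + 1) * h i ν
  rw [h0, norm_zero]
  have := Real.rpow_pos_of_pos hpos (-τ i ν)
  have hℓ : (0 : ℝ) < ℓ := by exact_mod_cast ℓ.pos
  positivity

theorem notMem_avoidSet_of_density (hd : 0 < d) (hU : ∀ ν, IsOpen (U ν))
    (hf : ∀ ν j, IsC2On (fun x => f ν x j) (U ν)) (hτpos : ∀ i ν, 0 < τ i ν)
    (hτsum : ∑ i, ∑ ν, τ i ν = ((d + m : ℕ) : ℝ) + 1)
    (hτdom : ∀ ν (i : Fin d) (j : Fin m), τ (Fin.natAdd d j) ν ≤ τ (Fin.castAdd m i) ν)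
    {α : S → ℝ} (hα0 : ∀ ν, 0 < α ν) (hα : ∀ i ν, α ν < τ i ν) {x : ZS S d} {ℓ : ℕ+} {T : ℕ}
    (hden : ∀ ν : S, (∀ i, 1 < τ i ν) ∨ ∀ C : ℝ, ∀ᶠ t : ℝ in atTop, ∀ b : Fin (d + m + 1) → ℤ,
      ‖b‖ = t → (∀ i (σ : S), ‖(b 0 : ℤ_[((σ : Nat.Primes) : ℕ)]) * graphMap f x σ i - b i.succ‖ ≤
        C * ‖b‖ ^ (-τ i σ)) → ∃ j, ‖b‖ ^ (-α ν) < ‖(b j : ℤ_[((ν : Nat.Primes) : ℕ)])‖)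
    (hdens : ∀ c : ℝ≥0∞, c < 1 → ∃ k : ℕ, ∀ (w : ZS S d) (l : S → Fin d → ℕ),
      (∀ ν i, k ≤ l ν i) → x ∈ boxS w l →
        c * haarS S d (boxS w l) ≤ haarS S d (avoidSet U f τ ℓ T ∩ boxS w l)) :
    x ∉ avoidSet U f τ ℓ T := by
  intro hx
  have hxU : ∀ ν, x ν ∈ U ν := fun ν => hx.1 ν (Set.mem_univ ν)
  choose q hq D hD using fun ν j => exists_integral_derivative (hU ν) (hf ν j) (hxU ν)
  have hℓ : (0 : ℝ) < 1 / (ℓ : ℝ) := by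
    have : (0 : ℝ) < ℓ := by exact_mod_cast ℓ.pos
    positivity
  -- The bound involving `q` is needed because the tangent estimate controls only `|q|` times the
  -- error.
  obtain ⟨η, ⟨hηℓ, hηq⟩, hη⟩ : ∃ η : ℝ, (η < 1 / (ℓ : ℝ) ∧
      ∀ ν j, η < 1 / (ℓ : ℝ) * ‖q ν j‖) ∧ 0 < η := by
    have h1 : ∀ᶠ η : ℝ in 𝓝[>] 0, η < 1 / (ℓ : ℝ) :=
      nhdsWithin_le_nhds (gt_mem_nhds hℓ)
    have h2 : ∀ᶠ η : ℝ in 𝓝[>] 0, ∀ ν j, η < 1 / (ℓ : ℝ) * ‖q ν j‖ :=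
      eventually_all.2 fun ν => eventually_all.2 fun j =>
        nhdsWithin_le_nhds (gt_mem_nhds (mul_pos hℓ (norm_pos_iff.2 (hq ν j))))
    exact ((h1.and h2).and self_mem_nhdsWithin).exists
  rcases exists_large_solutions hd hτpos hτsum hτdom (graphMap f x) q hq D hα0 hα hden hη with
    ⟨b, hb, h⟩ | ⟨C, hC, hsol⟩
  · exact notMem_avoidSet_of_rational hb h ℓ T hx
  have hpow : ∀ ν : S, Tendsto (fun s : ℕ => (((ν : Nat.Primes) : ℕ) : ℝ) ^ (-s : ℤ)) atTop
      (𝓝 0) := by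
    intro ν
    simp only [zpow_neg, zpow_natCast, ← inv_pow]
    exact tendsto_pow_atTop_nhds_zero_of_lt_one (by positivity)
      (inv_lt_one_of_one_lt₀ one_lt_cast_prime)
  -- The shrinking `s`, and with it `K`, depends on `C` and `η` but not on `b`, so the density
  -- threshold `c > 1 - K⁻¹` can be fixed before `b` is chosen.
  obtain ⟨s, hs⟩ : ∃ s : ℕ, ∀ ν : S, C * (((ν : Nat.Primes) : ℕ) : ℝ) *
      (((ν : Nat.Primes) : ℕ) : ℝ) ^ (-s : ℤ) ≤ η := by
    refine (eventually_all.2 fun ν => ?_ : ∀ᶠ s : ℕ in atTop, _).exists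
    have := (hpow ν).const_mul (C * (((ν : Nat.Primes) : ℕ) : ℝ))
    rw [mul_zero] at this
    exact (this.eventually (gt_mem_nhds hη)).mono fun s h => h.le
  have hpos : ∀ ν : S, (0 : ℝ) < (((ν : Nat.Primes) : ℕ) : ℝ) := fun ν => cast_prime_pos
  choose ρ hρ hder using fun (ν : S) j => hD ν j
    (η / (C * (((ν : Nat.Primes) : ℕ) : ℝ))) (div_pos hη (mul_pos hC (hpos ν)))
  set K : ℝ≥0∞ := ∏ ν : S, ∏ _i : Fin d, (((ν : Nat.Primes) : ℕ) : ℝ≥0∞) ^ s with hK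
  have hKt : K ≠ ⊤ := ENNReal.prod_ne_top fun ν _ => ENNReal.prod_ne_top fun i _ =>
    ENNReal.pow_ne_top (ENNReal.natCast_ne_top _)
  obtain ⟨c, hcK, hc1⟩ : ∃ c, 1 - K⁻¹ < c ∧ c < 1 :=
    exists_between (ENNReal.sub_lt_self ENNReal.one_ne_top one_ne_zero
      (ENNReal.inv_ne_zero.2 hKt))
  have hcK' : 1 < c + K⁻¹ := by
    by_contra! h
    exact absurd (ENNReal.le_sub_of_add_le_right (ne_top_of_le_ne_top ENNReal.one_ne_top
      (le_add_self.trans h)) h) (not_le.2 hcK)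
  obtain ⟨k₀, hk₀⟩ := hdens c hc1
  obtain ⟨k, hkρ, hkk⟩ : ∃ k : ℕ, (∀ (ν : S) j, (((ν : Nat.Primes) : ℕ) : ℝ) ^ (-k : ℤ) < ρ ν j) ∧
      k₀ ≤ k := by
    have h1 : ∀ᶠ k : ℕ in atTop, ∀ (ν : S) j, (((ν : Nat.Primes) : ℕ) : ℝ) ^ (-k : ℤ) < ρ ν j :=
      eventually_all.2 fun ν => eventually_all.2 fun j =>
        (hpow ν).eventually (gt_mem_nhds (hρ ν j))
    exact (h1.and (eventually_ge_atTop k₀)).exists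
  -- As `|b₀| ≥ ‖b‖^(-α)` and `α < τ`, this forces all sides of the box to level at least `k`, where
  -- both density and differentiability apply.
  have hlarge : ∀ᶠ t : ℝ in atTop, ∀ (ν : S) (i : Fin d),
      C * t ^ (-τ (Fin.castAdd m i) ν) ≤ (((ν : Nat.Primes) : ℕ) : ℝ) ^ (-k : ℤ) * t ^ (-α ν) :=
    eventually_all.2 fun ν => eventually_all.2 fun i =>
      eventually_const_mul_rpow_le (zpow_pos (hpos ν) _) (hα _ ν)
  obtain ⟨T', hT'⟩ := eventually_atTop.1 hlarge
  obtain ⟨b, hb, hbT, hl, hr, hb0⟩ := hsol (max T T')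
  have hb1 := one_le_norm_of_ne_zero hb
  have hbpos : 0 < ‖b‖ := by linarith
  have hb0' : ∀ ν : S, (b 0 : ℤ_[((ν : Nat.Primes) : ℕ)]) ≠ 0 := fun ν =>
    norm_pos_iff.1 ((Real.rpow_pos_of_pos hbpos _).trans_le (hb0 ν))
  simp only [graphMap_castAdd, graphMap_natAdd] at hl hr
  choose w l hkl hxw hsub using fun (ν : S) (i : Fin d) =>
    exists_padicBall_of_approx hC (Real.rpow_pos_of_pos hbpos (-τ (Fin.castAdd m i) ν)) (hs ν)
      (hb0' ν) (hl ν i) ((hT' ‖b‖ ((le_max_right _ _).trans hbT) ν i).trans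
        (mul_le_mul_of_nonneg_left (hb0 ν) (zpow_pos (hpos ν) _).le))
  have hVle : ∀ (ν : S) (i : Fin d) (j : Fin m),
      ‖b‖ ^ (-τ (Fin.castAdd m i) ν) ≤ ‖b‖ ^ (-τ (Fin.natAdd d j) ν) := fun ν i j =>
    Real.rpow_le_rpow_of_exponent_le hb1 (neg_le_neg (hτdom ν i j))
  have hdisj : Disjoint (avoidSet U f τ ℓ T) (boxS w fun ν i => l ν i + s) := by
    refine Set.disjoint_left.2 fun x' hx' hbox => ?_
    rw [mem_boxS] at hbox
    refine hx'.2 b ((le_max_left _ _).trans hbT) fun k' ν => ?_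
    have hV : ∀ k', 0 < ‖b‖ ^ (-τ k' ν) := fun k' => Real.rpow_pos_of_pos hbpos _
    refine Fin.addCases (fun i => ?_) (fun j => ?_) k'
    · rw [graphMap_castAdd]
      exact ((hsub ν i _ (hbox ν i)).1).trans_lt (mul_lt_mul_of_pos_right hηℓ (hV _))
    · rw [graphMap_natAdd]
      have hqpos : 0 < ‖q ν j‖ := norm_pos_iff.2 (hq ν j)
      have hxρ : ‖x' ν - x ν‖ < ρ ν j := by
        refine lt_of_le_of_lt ((pi_norm_le_iff_of_nonneg (zpow_pos (hpos ν) _).le).2 fun i => ?_)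
          (hkρ ν j)
        exact (hsub ν i _ (hbox ν i)).2.1
      have hCp : 0 < C * (((ν : Nat.Primes) : ℕ) : ℝ) := mul_pos hC (hpos ν)
      have key := norm_tangent_le hη.le (hV (Fin.natAdd d j)).le (div_pos hη hCp).le
        (div_mul_cancel₀ η hCp.ne').le (hb0' ν) (hder ν j (x' ν) hxρ)
        (mul_pos hCp (hV _)).le
        (fun i => ((hsub ν i _ (hbox ν i)).2.2).trans
          (mul_le_mul_of_nonneg_left (hVle ν i j) hCp.le))
        (fun i => ((hsub ν i _ (hbox ν i)).1).trans
          (mul_le_mul_of_nonneg_left (hVle ν i j) hη.le)) (hr ν j)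
      have hlt : ‖q ν j‖ * ‖(b 0 : ℤ_[((ν : Nat.Primes) : ℕ)]) * f ν (x' ν) j -
          b (Fin.natAdd d j).succ‖ < ‖q ν j‖ * (1 / (ℓ : ℝ) * ‖b‖ ^ (-τ (Fin.natAdd d j) ν)) := by
        refine key.trans_lt ?_
        calc η * ‖b‖ ^ (-τ (Fin.natAdd d j) ν)
            < (1 / (ℓ : ℝ) * ‖q ν j‖) * ‖b‖ ^ (-τ (Fin.natAdd d j) ν) :=
              mul_lt_mul_of_pos_right (hηq ν j) (hV _)
          _ = _ := by ring
      exact lt_of_mul_lt_mul_left hlt hqpos.le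
  have hsubbox : (boxS w fun ν i => l ν i + s) ⊆ boxS w l := fun z hz =>
    mem_boxS.2 fun ν i => padicBall_anti _ (Nat.le_add_right _ _) (mem_boxS.1 hz ν i)
  exact absurd (hk₀ w l (fun ν i => hkk.trans (hkl ν i)) (mem_boxS.2 hxw))
    (not_le.2 (not_dense_of_disjoint (measurableSet_boxS _ _) hsubbox hdisj (haarS_boxS_pos w l)
      (haarS_boxS_le w l s) hcK'))

end Avoid

end SArith

end

/-! ### Assembly: denominator bounds at each place and the density argument. -/

theorem theorem8p8 (S : Finset Nat.Primes) (d m : ℕ) (hd : 0 < d)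
    (U : (ν : S) → Set (Fin d → ℤ_[((ν : Nat.Primes) : ℕ)]))
    (hU : ∀ ν, IsOpen (U ν))
    (f : (ν : S) → (Fin d → ℤ_[((ν : Nat.Primes) : ℕ)]) →
      Fin m → ℤ_[((ν : Nat.Primes) : ℕ)])
    (hf : ∀ ν j, SArith.IsC2On (fun x => f ν x j) (U ν))
    (τ : Fin (d + m) → S → ℝ)
    (hτpos : ∀ i ν, 0 < τ i ν)
    (hτsum : ∑ i, ∑ ν, τ i ν = ((d + m : ℕ) : ℝ) + 1)
    (hτdom : ∀ ν (i : Fin d) (j : Fin m), τ (Fin.natAdd d j) ν ≤ τ (Fin.castAdd m i) ν)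
    (hτone : ∀ i, 1 < ∑ ν, τ i ν)
    (hexp : ∀ ν : S, (∃ i, τ i ν ≤ 1) →
      ∃ α : ℝ, 0 < α ∧ (∀ i σ, α < τ i σ) ∧
        SArith.manifoldExponent (SArith.modWeights τ ν α) (Set.univ.pi U) (SArith.graphMap f)
          < ((1 + α / ((1 - α) * (((d + m : ℕ) : ℝ) + 1)) : ℝ) : EReal)) :
    SArith.haarS S d (Set.univ.pi U ∩ SArith.graphMap f ⁻¹' SArith.Bad τ) = 0 := by
  have hplace : ∀ ν : S, ∃ α : ℝ, 0 < α ∧ (∀ i, α < τ i ν) ∧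
      ∀ᵐ x ∂SArith.haarS S d, x ∈ Set.univ.pi U → ((∀ i, 1 < τ i ν) ∨
        ∀ C : ℝ, ∀ᶠ t : ℝ in Filter.atTop, ∀ b : Fin (d + m + 1) → ℤ, ‖b‖ = t →
          (∀ i (σ : S), ‖(b 0 : ℤ_[((σ : Nat.Primes) : ℕ)]) * SArith.graphMap f x σ i -
            b i.succ‖ ≤ C * ‖b‖ ^ (-τ i σ)) →
          ∃ j, ‖b‖ ^ (-α) < ‖(b j : ℤ_[((ν : Nat.Primes) : ℕ)])‖) := by
    intro ν
    by_cases h : ∀ i, 1 < τ i ν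
    -- Here only `α < τ i ν` is required, and `α = 1` qualifies because all weights at this place
    -- exceed 1.
    · exact ⟨1, one_pos, h, Filter.Eventually.of_forall fun x _ => Or.inl h⟩
    push Not at h
    obtain ⟨α, hα0, hα, hM⟩ := hexp ν h
    obtain ⟨i₀, hi₀⟩ := h
    -- The exponent hypothesis is invoked only when some weight at `ν` is at most 1, which bounds
    -- `α`.
    have hα1 : α < 1 := (hα i₀ ν).trans_le hi₀
    obtain ⟨ω, hω, hlt⟩ := sInf_lt_iff.1 hM
    refine ⟨α, hα0, fun i => hα i ν, ?_⟩
    filter_upwards [hω] with x hx hxU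
    exact Or.inr fun C => SArith.exists_norm_gt_of_pointExponent_le hα0 hα1 hα hlt (hx hxU) C
  choose α hα0 hα hae using hplace
  refine measure_mono_null SArith.bad_subset_iUnion_avoidSet
    (measure_iUnion_null fun ℓ => measure_iUnion_null fun T => ?_)
  rw [measure_eq_zero_iff_ae_notMem]
  filter_upwards [MeasureTheory.ae_all_iff.2 hae,
    SArith.ae_strong_density (SArith.measurableSet_avoidSet hU (fun ν j => (hf ν j).1) ℓ T)]
    with x hx hdens hmem
  exact SArith.notMem_avoidSet_of_density hd hU hf hτpos hτsum hτdom hα0 (fun i ν => hα ν i)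
    (fun ν => hx ν hmem.1) (hdens hmem) hmem
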